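/- Let $n\ge 2$ and let $D\subset\mathbb R^n$ be a bounded domain (a non-empty connected open set) on which every Dirichlet problem is solvable: for every continuous $f:\partial D\to\mathbb R$ there is a function that is harmonic in $D$, continuous on $\overline D$ and equal to $f$ on $\partial D$. For $p\in D$ let $v_p$ be the regular part of the Green's function of $D$ with pole $p$, that is, the function that is harmonic in $D$, continuous on $\overline D$, and satisfies, for $z\in\partial D$, $$v_p(z)=-\ln\frac1{|z-p|}\ \text{ if } n=2,\qquad v_p(z)=-\frac1{|z-p|^{\,n-2}}\ \text{ if } n>2 .$$ For $\varepsilon>0$ and $x\in D$ such that the closed ball $\overline B_\varepsilon(x)$ is contained in $D$, let $S_\varepsilon(x)=\partial B_\varepsilon(x)$, and let $u$ be the function that is harmonic in $D\setminus\overline B_\varepsilon(x)$, continuous up to the boundary, equal to $1$ on $S_\varepsilon(x)$ and to $0$ on $\partial D$. Let $$F_\varepsilon(x)=-\int_{S_\varepsilon(x)}\nabla u\cdot\mathbf n\,dS$$ be its flux, where $\mathbf n$ is the unit normal pointing out of the ball and $\nabla u$ on $S_\varepsilon(x)$ is the continuous extension of the gradient from outside the ball. Call $c\in\mathbb R^n$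 a least capacity point of $D$ if $c=\lim_{\varepsilon\to0^+}x_\varepsilon$, where, for every sufficiently small $\varepsilon>0$, $x_\varepsilon$ is a minimizer of $F_\varepsilon$ over all $x$ with $\overline B_\varepsilon(x)\subset D$. Then every least capacity point $c$ of $D$ lies in $D$ and maximizes the function $z\mapsto v_z(z)$ on $D$: $v_z(z)\le v_c(c)$ for all $z\in D$. -/

import Mathlib

open Set Filter Topology MeasureTheory InnerProductSpace

noncomputable section

/-- `u` solves the Dirichlet problem on the open set `U` with boundary values `f`: it is harmonic
in `U`, continuous on the closure of `U`, and equal to `f` on the boundary of `U`. -/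
def SolvesDirichlet {n : ℕ} (U : Set (EuclideanSpace ℝ (Fin n)))
    (f u : EuclideanSpace ℝ (Fin n) → ℝ) : Prop :=
  HarmonicContOnCl u U ∧ ∀ y ∈ frontier U, u y = f y

/-- Every Dirichlet problem on `U` with continuous boundary values has a solution. -/
def DirichletSolvable {n : ℕ} (U : Set (EuclideanSpace ℝ (Fin n))) : Prop :=
  ∀ f : EuclideanSpace ℝ (Fin n) → ℝ, ContinuousOn f (frontier U) → ∃ u, SolvesDirichlet U f u

/-- The radial singularity of the Green's function of `ℝⁿ`, at distance `r` from the pole: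
`ln (1 / r)` if `n = 2`, and `1 / r ^ (n - 2)` if `n > 2`. -/
def greenSingularity (n : ℕ) (r : ℝ) : ℝ :=
  if n = 2 then Real.log (1 / r) else 1 / r ^ (n - 2)

/-- `v` is the regular part of the Green's function of `D` with pole `p`: the harmonic function
which makes `v z + greenSingularity n |z - p|` vanish for `z` on the boundary of `D`. -/
def IsGreenRegularPart {n : ℕ} (D : Set (EuclideanSpace ℝ (Fin n)))
    (p : EuclideanSpace ℝ (Fin n)) (v : EuclideanSpace ℝ (Fin n) → ℝ) : Prop :=
  SolvesDirichlet D (fun z => -greenSingularity n ‖z - p‖) v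

/-- `u` is harmonic in `D` with the closed ball of radius `ε` about `x` removed, continuous up to
the boundary, equal to `1` on the sphere of radius `ε` about `x`, and to `0` on the boundary
of `D`. -/
def IsCoredPotential {n : ℕ} (D : Set (EuclideanSpace ℝ (Fin n))) (ε : ℝ)
    (x : EuclideanSpace ℝ (Fin n)) (u : EuclideanSpace ℝ (Fin n) → ℝ) : Prop :=
  HarmonicContOnCl u (D \ Metric.closedBall x ε) ∧
    (∀ y ∈ Metric.sphere x ε, u y = 1) ∧ ∀ y ∈ frontier D, u y = 0

/-- `g` is the gradient of `u` in `D` outside the closed ball of radius `ε` about `x`, extended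
continuously (from outside the ball) to the sphere of radius `ε` about `x`. -/
def IsGradientUpToSphere {n : ℕ} (D : Set (EuclideanSpace ℝ (Fin n))) (ε : ℝ)
    (x : EuclideanSpace ℝ (Fin n)) (u : EuclideanSpace ℝ (Fin n) → ℝ)
    (g : EuclideanSpace ℝ (Fin n) → EuclideanSpace ℝ (Fin n)) : Prop :=
  ContinuousOn g (D \ Metric.ball x ε) ∧ ∀ y ∈ D \ Metric.closedBall x ε, g y = gradient u y

/-- The flux `-∫ ⟪g, ν⟫ dS` of the field `-g` through the sphere of radius `ε` about `x`, where `ν`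
is the outward unit normal and `dS` the surface measure. The sphere is parametrized as `x + ε θ`
with `θ` in the unit sphere, so that `ν = θ` and `dS = ε ^ (n - 1) dθ`. -/
def sphereFlux {n : ℕ} (ε : ℝ) (x : EuclideanSpace ℝ (Fin n))
    (g : EuclideanSpace ℝ (Fin n) → EuclideanSpace ℝ (Fin n)) : ℝ :=
  -(ε ^ (n - 1) * ∫ θ : Metric.sphere (0 : EuclideanSpace ℝ (Fin n)) 1,
      inner ℝ (g (x + ε • (θ : EuclideanSpace ℝ (Fin n)))) (θ : EuclideanSpace ℝ (Fin n))
        ∂(volume : Measure (EuclideanSpace ℝ (Fin n))).toSphere)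

/-- The closed ball of radius `ε > 0` about `x` lies in `D`, and `F` is the heat flux `F_ε(x)` from
the sphere of radius `ε` about `x` (held at temperature `1`) to the boundary of `D` (held at
temperature `0`). -/
def IsFlux {n : ℕ} (D : Set (EuclideanSpace ℝ (Fin n))) (ε : ℝ)
    (x : EuclideanSpace ℝ (Fin n)) (F : ℝ) : Prop :=
  0 < ε ∧ Metric.closedBall x ε ⊆ D ∧
    ∃ u g, IsCoredPotential D ε x u ∧ IsGradientUpToSphere D ε x u g ∧ F = sphereFlux ε x g

/-- `x` minimizes the flux `F_ε` over all centers of closed balls of radius `ε` in `D`. -/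
def IsFluxMinimizer {n : ℕ} (D : Set (EuclideanSpace ℝ (Fin n))) (ε : ℝ)
    (x : EuclideanSpace ℝ (Fin n)) : Prop :=
  ∃ F, IsFlux D ε x F ∧ ∀ y G, IsFlux D ε y G → F ≤ G

/-- `c` is a least capacity point of `D`: the limit, as `ε → 0⁺`, of minimizers `x ε` of the
flux `F_ε`. (The limit is taken in `ℝⁿ`; it is not required to lie in `D`.) -/
def IsLeastCapacityPoint {n : ℕ} (D : Set (EuclideanSpace ℝ (Fin n)))
    (c : EuclideanSpace ℝ (Fin n)) : Prop :=
  ∃ x : ℝ → EuclideanSpace ℝ (Fin n),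
    (∀ᶠ ε in 𝓝[>] (0 : ℝ), IsFluxMinimizer D ε (x ε)) ∧ Tendsto x (𝓝[>] (0 : ℝ)) (𝓝 c)

end

set_option linter.unusedSectionVars false

open Laplacian

/-! ### Second derivatives along lines and the maximum principle -/

section MaximumPrinciple

variable {E : Type*} [NormedAddCommGroup E] [InnerProductSpace ℝ E]

/-! Write g for `greenSingularity n` and γ for `greenFlux n`. The Green's function G = g(|· - x|) +
v_x vanishes on ∂D, equals g(ε) + v_x on the sphere S_ε(x), and has flux γ through it, whatever x
and ε are. For harmonic functions with the same values on ∂D, the flux is monotone in the values on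
the sphere. Comparing G with multiples of the potential u therefore gives m F ≤ γ ≤ M F whenever m ≤
g(ε) + v_x ≤ M on the sphere (`IsFlux.le_greenFlux`, `IsFlux.greenFlux_le`). A small flux thus
forces large values of v_x near x: for small ε the sphere about a minimizer x_ε contains a point y
with v_{x_ε}(y) ≥ v_z(z) - δ (`eventually_exists_sphere_le`). Now let ε → 0. If c were on ∂D, the
left side would tend to -∞ (`exists_forall_greenRegularPart_lt`). Hence c ∈ D, and upper
semicontinuity in the pole (`eventually_greenRegularPart_le`) with continuity of v_c turns the
inequality into v_c(c) ≥ v_z(z).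

Since ∂D may be irregular, no divergence theorem is used on D. The flux is the limit of ∫ ∇u·∇η over
radial cutoffs η concentrating at the sphere, and its monotonicity follows from Green's identity
with the test function η ψ(w), where ψ cuts off small values of w and so makes the support compact.

The comparison also needs the competitor z to have a flux, although solvability is assumed only on D
and the gradient must extend to the sphere. Both come from an explicit potential u = (h - K[h -
h(z)] + g(|· - z|)) / (g(ε) + h(z)), with K the Kelvin transform in the sphere and h harmonic in D.
The condition u = 0 on ∂D is a fixed-point equation for the boundary values of h, contracting for
small ε by an interior Lipschitz estimate (`exists_harmonic_eq_kelvinTransform`,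
`eventually_exists_isFlux`). -/

theorem ContDiffAt.hasFDerivAt_fderiv_apply {f : E → ℝ} {x : E} (hf : ContDiffAt ℝ 2 f x) (e : E) :
    HasFDerivAt (fun z => fderiv ℝ f z e) ((fderiv ℝ (fderiv ℝ f) x).flip e) x := by
  have h : DifferentiableAt ℝ (fderiv ℝ f) x :=
    (hf.fderiv_right (m := 1) (by norm_num)).differentiableAt (by norm_num)
  simpa using h.hasFDerivAt.clm_apply (hasFDerivAt_const e x)

theorem hasDerivAt_line (x e : E) (t : ℝ) : HasDerivAt (fun t : ℝ => x + t • e) e t := by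
  simpa using ((hasDerivAt_id t).smul_const e).const_add x

/-- A Laplacian needs only pure second derivatives, so two one-variable differentiations along a
line suffice. The explicit Laplacians below are computed this way. -/
theorem iteratedFDeriv_two_eq_of_hasDerivAt {f q : E → ℝ} {x e : E} {q' : ℝ}
    (hf : ContDiffAt ℝ 2 f x) (hq : ∀ᶠ z in 𝓝 x, fderiv ℝ f z e = q z)
    (hq' : HasDerivAt (fun t : ℝ => q (x + t • e)) q' 0) :
    iteratedFDeriv ℝ 2 f x ![e, e] = q' := by
  rw [iteratedFDeriv_two_apply]
  have hline := hasDerivAt_line x e 0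
  have h1 : HasDerivAt (fun t : ℝ => fderiv ℝ f (x + t • e) e)
      (fderiv ℝ (fderiv ℝ f) x e e) 0 := (hf.hasFDerivAt_fderiv_apply e).hasLineDerivAt e
  have h3 : (fun t : ℝ => fderiv ℝ f (x + t • e) e) =ᶠ[𝓝 0] fun t : ℝ => q (x + t • e) := by
    have : Tendsto (fun t : ℝ => x + t • e) (𝓝 0) (𝓝 x) := by
      simpa using hline.continuousAt.tendsto
    exact this.eventually hq
  exact (h1.congr_of_eventuallyEq h3.symm).unique hq'

/-- A negative second derivative would make the point a local maximum along the line as well, so the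
function would be locally constant there and the second derivative zero. -/
theorem IsLocalMin.iteratedFDeriv_two_nonneg {f : E → ℝ} {x : E} (hf : ContDiffAt ℝ 2 f x)
    (hmin : IsLocalMin f x) (e : E) : 0 ≤ iteratedFDeriv ℝ 2 f x ![e, e] := by
  by_contra! hneg
  have hline := hasDerivAt_line x e
  have htend : Tendsto (fun t : ℝ => x + t • e) (𝓝 0) (𝓝 x) := by
    simpa using (hline 0).continuousAt.tendsto
  have hd : deriv (fun t : ℝ => f (x + t • e)) =ᶠ[𝓝 0] fun t => fderiv ℝ f (x + t • e) e := by
    have h1 : ∀ᶠ z in 𝓝 x, DifferentiableAt ℝ f z :=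
      (hf.eventually (by simp)).mono fun z hz => hz.differentiableAt (by norm_num)
    filter_upwards [htend.eventually h1] with t ht
    exact (ht.hasFDerivAt.comp_hasDerivAt t (hline t)).deriv
  have h2 : deriv (deriv (fun t : ℝ => f (x + t • e))) 0 = iteratedFDeriv ℝ 2 f x ![e, e] := by
    rw [hd.deriv_eq]
    rw [HasDerivAt.deriv ((hf.hasFDerivAt_fderiv_apply e).hasLineDerivAt e),
      iteratedFDeriv_two_apply]
    simp
  have hmin' : IsLocalMin (fun t : ℝ => f (x + t • e)) 0 := by
    have := htend.eventually hmin
    simpa [IsLocalMin, IsMinFilter] using this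
  have hcont : ContinuousAt (fun t : ℝ => f (x + t • e)) 0 := by
    have hfc : ContinuousAt f (x + (0 : ℝ) • e) := by simpa using hf.continuousAt
    exact hfc.comp (f := fun t : ℝ => x + t • e) (hline 0).continuousAt
  have hmax := isLocalMax_of_deriv_deriv_neg (by rw [h2]; exact hneg) hmin'.deriv_eq_zero hcont
  have hconst : (fun t : ℝ => f (x + t • e)) =ᶠ[𝓝 0] fun _ => f (x + (0 : ℝ) • e) := by
    filter_upwards [hmin', hmax] with t h1 h2 using le_antisymm h2 h1
  have : deriv (deriv (fun t : ℝ => f (x + t • e))) 0 = 0 := by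
    rw [hconst.deriv.deriv_eq]; simp
  rw [← h2, this] at hneg
  exact lt_irrefl _ hneg

theorem fderiv_norm_sq_sub (c z e : E) :
    fderiv ℝ (fun y : E => ‖y - c‖ ^ 2) z e = 2 * inner ℝ (z - c) e := by
  have := ((hasFDerivAt_id z).sub_const c).norm_sq
  rw [show (fun y : E => ‖y - c‖ ^ 2) = fun y => ‖id y - c‖ ^ 2 from rfl, this.fderiv]
  simp [two_mul, inner_sub_left]

theorem iteratedFDeriv_two_norm_sq_sub (c x e : E) :
    iteratedFDeriv ℝ 2 (fun y : E => ‖y - c‖ ^ 2) x ![e, e] = 2 * ‖e‖ ^ 2 := by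
  refine iteratedFDeriv_two_eq_of_hasDerivAt (q := fun z => 2 * inner ℝ (z - c) e) ?_
    (.of_forall fun z => fderiv_norm_sq_sub c z e) ?_
  · exact ((contDiff_id.sub contDiff_const).norm_sq ℝ).contDiffAt
  · have h : (fun t : ℝ => 2 * inner ℝ (x + t • e - c) e)
        = fun t => 2 * inner ℝ (x - c) e + t * (2 * ‖e‖ ^ 2) := by
      funext t
      rw [show x + t • e - c = (x - c) + t • e by abel, inner_add_left, real_inner_smul_left,
        real_inner_self_eq_norm_sq]
      ring
    rw [h]
    simpa using ((hasDerivAt_id (0 : ℝ)).mul_const (2 * ‖e‖ ^ 2)).const_add (2 * inner ℝ (x - c) e)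

variable [FiniteDimensional ℝ E]

theorem IsLocalMin.laplacian_nonneg {f : E → ℝ} {x : E} (hf : ContDiffAt ℝ 2 f x)
    (hmin : IsLocalMin f x) : 0 ≤ (Δ f) x := by
  rw [laplacian_eq_iteratedFDeriv_stdOrthonormalBasis]
  exact Finset.sum_nonneg fun i _ => hmin.iteratedFDeriv_two_nonneg hf _

theorem laplacian_norm_sq_sub (c x : E) :
    (Δ (fun y : E => ‖y - c‖ ^ 2)) x = 2 * (Module.finrank ℝ E : ℝ) := by
  rw [laplacian_eq_iteratedFDeriv_stdOrthonormalBasis]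
  simp [iteratedFDeriv_two_norm_sq_sub, mul_comm]

/-- The weak minimum principle for harmonic functions on a bounded open set. -/
theorem InnerProductSpace.HarmonicOnNhd.nonneg_of_frontier [Nontrivial E] {U : Set E}
    (hUo : IsOpen U) (hUb : Bornology.IsBounded U) {w : E → ℝ} (hw : HarmonicOnNhd w U)
    (hwc : ContinuousOn w (closure U)) (hfr : ∀ y ∈ frontier U, 0 ≤ w y) :
    ∀ y ∈ closure U, 0 ≤ w y := by
  intro p hp
  by_contra! hneg
  obtain ⟨R, hR⟩ := hUb.closure.exists_norm_le
  -- Subtracting δ(|y|² - R²) makes the Laplacian strictly negative and does not lower boundary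
  -- values, as |y| ≤ R. This δ is small enough that the value at `p` stays below `w p / 2`.
  set δ : ℝ := -w p / (2 * (R ^ 2 + 1)) with hδ
  have hδ0 : 0 < δ := by apply div_pos <;> [linarith; positivity]
  set W : E → ℝ := fun y => w y - δ * (‖y - 0‖ ^ 2 - R ^ 2) with hW
  have hWc : ContinuousOn W (closure U) :=
    hwc.sub (by fun_prop)
  obtain ⟨q, hq, hqmin⟩ := hUb.isCompact_closure.exists_isMinOn ⟨p, hp⟩ hWc
  have hWp : W p < 0 := by
    have : δ * (R ^ 2 + 1) = -w p / 2 := by rw [hδ]; field_simp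
    have h2 : 0 ≤ δ * ‖p - 0‖ ^ 2 := by positivity
    simp only [hW]
    nlinarith
  have hWq : W q < 0 := (hqmin hp).trans_lt hWp
  have hqU : q ∈ U := by
    by_contra hqU
    have h1 := hfr q ⟨hq, fun h => hqU (interior_subset h)⟩
    have h2 : ‖q‖ ^ 2 ≤ R ^ 2 := pow_le_pow_left₀ (norm_nonneg _) (hR q hq) 2
    simp only [hW, sub_zero] at hWq
    nlinarith
  have hloc : IsLocalMin W q := hqmin.isLocalMin (mem_of_superset (hUo.mem_nhds hqU) subset_closure)
  have hcd : ContDiffAt ℝ 2 (fun y : E => ‖y - 0‖ ^ 2) q :=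
    ((contDiff_id.sub contDiff_const).norm_sq ℝ).contDiffAt
  have hcd' : ContDiffAt ℝ 2 (δ • (fun y : E => ‖y - 0‖ ^ 2) - fun _ => δ * R ^ 2) q :=
    (hcd.const_smul δ).sub contDiffAt_const
  have hWeq : W = w - (δ • (fun y : E => ‖y - 0‖ ^ 2) - fun _ => δ * R ^ 2) := by
    funext y; simp [hW, mul_sub]
  have hWcd : ContDiffAt ℝ 2 W q := by
    rw [hWeq]
    exact (hw q hqU).1.sub hcd'
  have hlap := hloc.laplacian_nonneg hWcd
  rw [hWeq, (hw q hqU).1.laplacian_sub hcd',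
    ContDiffAt.laplacian_sub (f₁ := δ • fun y : E => ‖y - 0‖ ^ 2) (hcd.const_smul δ)
      contDiffAt_const, laplacian_smul δ hcd,
    (hw q hqU).2.self_of_nhds, laplacian_norm_sq_sub] at hlap
  have : (0 : ℝ) < Module.finrank ℝ E := by exact_mod_cast Module.finrank_pos
  simp at hlap
  nlinarith [mul_pos hδ0 this]

/-- The comparison principle for harmonic functions on a bounded open set. -/
theorem InnerProductSpace.HarmonicContOnCl.le_of_frontier [Nontrivial E] {U : Set E}
    (hUo : IsOpen U) (hUb : Bornology.IsBounded U) {w₁ w₂ : E → ℝ} (h₁ : HarmonicContOnCl w₁ U)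
    (h₂ : HarmonicContOnCl w₂ U) (hfr : ∀ y ∈ frontier U, w₁ y ≤ w₂ y) :
    ∀ y ∈ closure U, w₁ y ≤ w₂ y := by
  intro y hy
  have h := h₂.sub h₁
  have := h.1.nonneg_of_frontier hUo hUb h.2 (fun z hz => by simpa using hfr z hz) y hy
  simpa using this

theorem InnerProductSpace.HarmonicContOnCl.abs_le_of_frontier [Nontrivial E] {U : Set E}
    (hUo : IsOpen U) (hUb : Bornology.IsBounded U) {w : E → ℝ} {M : ℝ} (h : HarmonicContOnCl w U)
    (hfr : ∀ y ∈ frontier U, |w y| ≤ M) : ∀ y ∈ closure U, |w y| ≤ M := fun y hy =>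
  abs_le.2 ⟨harmonicContOnCl_const.le_of_frontier hUo hUb h (fun z hz => (abs_le.1 (hfr z hz)).1) y hy,
    h.le_of_frontier hUo hUb harmonicContOnCl_const (fun z hz => (abs_le.1 (hfr z hz)).2) y hy⟩

end MaximumPrinciple

/-! ### Green's first identity with compactly supported test functions -/

section Green

theorem integrable_of_continuousOn_of_support {E : Type*} [NormedAddCommGroup E]
    [MeasurableSpace E] [BorelSpace E] {μ : Measure E} [IsFiniteMeasureOnCompacts μ]
    {U K : Set E} (hK : IsCompact K) (hKU : K ⊆ U)
    {f : E → ℝ} (hf : ContinuousOn f U) (hf0 : ∀ y ∉ K, f y = 0) : Integrable f μ :=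
  (integrableOn_iff_integrable_of_support_subset fun y hy => by
    by_contra h; exact hy (hf0 y h)).1 ((hf.mono hKU).integrableOn_compact hK)

variable {E : Type*} [NormedAddCommGroup E] [InnerProductSpace ℝ E]

theorem fderiv_eq_zero_of_notMem {f : E → ℝ} {K : Set E} (hK : IsClosed K)
    (hf : ∀ y ∉ K, f y = 0) {y : E} (hy : y ∉ K) : fderiv ℝ f y = 0 := by
  have : f =ᶠ[𝓝 y] fun _ => 0 := by
    filter_upwards [hK.isOpen_compl.mem_nhds hy] with z hz using hf z hz
  rw [this.fderiv_eq]; simp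

variable [FiniteDimensional ℝ E]

theorem inner_gradient_eq_sum {w φ : E → ℝ} (y : E) :
    inner ℝ (gradient w y) (gradient φ y) = ∑ i, fderiv ℝ w y (stdOrthonormalBasis ℝ E i) *
      fderiv ℝ φ y (stdOrthonormalBasis ℝ E i) := by
  rw [← (stdOrthonormalBasis ℝ E).sum_inner_mul_inner]
  refine Finset.sum_congr rfl fun i _ => ?_
  rw [gradient, gradient, InnerProductSpace.toDual_symm_apply, real_inner_comm,
    InnerProductSpace.toDual_symm_apply]

theorem ContDiffAt.continuousAt_gradient {f : E → ℝ} {x : E} (hf : ContDiffAt ℝ 1 f x) :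
    ContinuousAt (gradient f) x :=
  (InnerProductSpace.toDual ℝ E).symm.continuous.continuousAt.comp
    (hf.fderiv_right (m := 0) (by norm_num)).continuousAt

variable [MeasurableSpace E] [BorelSpace E] {μ : Measure E} [μ.IsAddHaarMeasure]

/-- Green's first identity for a harmonic function and a compactly supported test function. -/
theorem InnerProductSpace.HarmonicOnNhd.integral_inner_gradient_eq_zero {U K : Set E}
    {w φ : E → ℝ} (hw : HarmonicOnNhd w U) (hφ : ∀ y ∈ U, ContDiffAt ℝ 1 φ y)
    (hK : IsCompact K) (hKU : K ⊆ U) (hφ0 : ∀ y ∉ K, φ y = 0) :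
    ∫ y, inner ℝ (gradient w y) (gradient φ y) ∂μ = 0 := by
  set b := stdOrthonormalBasis ℝ E
  have hcw : ∀ i, ContinuousOn (fun y => fderiv ℝ w y (b i)) U := fun i y hy =>
    ((hw y hy).1.hasFDerivAt_fderiv_apply (b i)).continuousAt.continuousWithinAt
  have hcφ : ∀ i, ContinuousOn (fun y => fderiv ℝ φ y (b i)) U := fun i y hy =>
    (((hφ y hy).fderiv_right (m := 0) (by norm_num)).continuousAt.clm_apply
      continuousAt_const).continuousWithinAt
  have hcφ0 : ContinuousOn φ U := fun y hy => (hφ y hy).continuousAt.continuousWithinAt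
  have hcw2 : ∀ i, ContinuousOn (fun y => fderiv ℝ (fun z => fderiv ℝ w z (b i)) y (b i)) U := by
    intro i y hy
    have h2 : ContDiffAt ℝ 1 (fun z => fderiv ℝ w z (b i)) y :=
      ((hw y hy).1.fderiv_right (m := 1) (by norm_num)).clm_apply contDiffAt_const
    exact ((h2.fderiv_right (m := 0) (by norm_num)).continuousAt.clm_apply
      continuousAt_const).continuousWithinAt
  have htsφ : tsupport φ ⊆ K := closure_minimal (fun y hy => by
    by_contra h; exact hy (hφ0 y h)) hK.isClosed
  have hdφ : ∀ y, DifferentiableAt ℝ φ y := by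
    intro y
    by_cases hy : y ∈ U
    · exact (hφ y hy).differentiableAt (by norm_num)
    · have : φ =ᶠ[𝓝 y] fun _ => 0 := by
        filter_upwards [hK.isClosed.isOpen_compl.mem_nhds fun h => hy (hKU h)] with z hz
          using hφ0 z hz
      exact (differentiableAt_const (0 : ℝ)).congr_of_eventuallyEq this
  have hfφ0 : ∀ y ∉ K, fderiv ℝ φ y = 0 := fun y hy => fderiv_eq_zero_of_notMem hK.isClosed hφ0 hy
  have hI1 : ∀ i, Integrable (fun y => fderiv ℝ w y (b i) * fderiv ℝ φ y (b i)) μ := fun i =>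
    integrable_of_continuousOn_of_support hK hKU ((hcw i).mul (hcφ i))
      fun y hy => by simp [hfφ0 y hy]
  have hI2 : ∀ i, Integrable (fun y => fderiv ℝ (fun z => fderiv ℝ w z (b i)) y (b i) * φ y) μ :=
    fun i => integrable_of_continuousOn_of_support hK hKU ((hcw2 i).mul hcφ0)
      fun y hy => by simp [hφ0 y hy]
  -- Integration by parts one coordinate at a time; the sum of the right-hand sides contains the
  -- Laplacian of `w`.
  have hibp : ∀ i, ∫ y, fderiv ℝ w y (b i) * fderiv ℝ φ y (b i) ∂μ
      = -∫ y, fderiv ℝ (fun z => fderiv ℝ w z (b i)) y (b i) * φ y ∂μ := fun i =>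
    integral_mul_fderiv_eq_neg_fderiv_mul_of_integrable (hI2 i) (hI1 i)
      (integrable_of_continuousOn_of_support hK hKU ((hcw i).mul hcφ0)
        fun y hy => by simp [hφ0 y hy])
      (fun y hy => ((hw y (hKU (htsφ hy))).1.hasFDerivAt_fderiv_apply (b i)).differentiableAt)
      (fun y _ => hdφ y)
  simp_rw [inner_gradient_eq_sum]
  rw [integral_finsetSum _ fun i _ => hI1 i, Finset.sum_congr rfl fun i _ => hibp i,
    Finset.sum_neg_distrib, ← integral_finsetSum _ fun i _ => hI2 i, neg_eq_zero]
  refine integral_eq_zero_of_ae (.of_forall fun y => ?_)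
  by_cases hy : y ∈ K
  · have hlap := (hw y (hKU hy)).2.self_of_nhds
    rw [laplacian_eq_iteratedFDeriv_stdOrthonormalBasis, Pi.zero_apply] at hlap
    simp only [Pi.zero_apply, ← Finset.sum_mul]
    rw [mul_eq_zero]
    left
    rw [← hlap]
    refine Finset.sum_congr rfl fun i _ => ?_
    rw [((hw y (hKU hy)).1.hasFDerivAt_fderiv_apply (b i)).fderiv, iteratedFDeriv_two_apply]
    simp [b]
  · simp [hφ0 y hy]

end Green

/-! ### The sign of the flux -/

section FluxSign

variable {E : Type*} [NormedAddCommGroup E] [InnerProductSpace ℝ E] [FiniteDimensional ℝ E]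

theorem real_inner_gradient_right {f : E → ℝ} (v y : E) : inner ℝ v (gradient f y) = fderiv ℝ f y v := by
  rw [real_inner_comm, gradient, InnerProductSpace.toDual_symm_apply]

theorem gradient_eq_zero_iff_fderiv {f : E → ℝ} {y : E} : gradient f y = 0 ↔ fderiv ℝ f y = 0 := by
  simp [gradient]

/-- A smooth nondecreasing cutoff vanishing for `t ≤ 1 / (k + 1)` and equal to `1` for
`2 / (k + 1) ≤ t`. -/
noncomputable def valueCutoff (k : ℕ) (t : ℝ) : ℝ := Real.smoothTransition ((k + 1) * t - 1)

theorem contDiff_valueCutoff (k : ℕ) : ContDiff ℝ 1 (valueCutoff k) :=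
  Real.smoothTransition.contDiff.comp (by fun_prop)

theorem valueCutoff_eq_zero {k : ℕ} {t : ℝ} (ht : (k + 1) * t ≤ 1) : valueCutoff k t = 0 :=
  Real.smoothTransition.zero_of_nonpos (by linarith)

theorem valueCutoff_monotone (k : ℕ) : Monotone (valueCutoff k) := fun s t h =>
  Real.smoothTransition.monotone (by gcongr)

theorem tendsto_valueCutoff {t : ℝ} (ht : 0 < t) :
    Tendsto (fun k => valueCutoff k t) atTop (𝓝 1) := by
  obtain ⟨N, hN⟩ := exists_nat_gt (2 / t)
  refine tendsto_const_nhds.congr' ?_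
  filter_upwards [eventually_ge_atTop N] with k hk
  have h1 : (N : ℝ) ≤ k := by exact_mod_cast hk
  rw [div_lt_iff₀ ht] at hN
  exact (Real.smoothTransition.one_of_one_le (by nlinarith)).symm

variable [MeasurableSpace E] [BorelSpace E] {μ : Measure E} [μ.IsAddHaarMeasure]

/-- A nonnegative harmonic function which vanishes on the part of the boundary met by the support
of the cutoff `η` has nonnegative flux towards that part. -/
theorem InnerProductSpace.HarmonicContOnCl.integral_inner_gradient_nonpos {U K : Set E}
    (hUo : IsOpen U) (hUb : Bornology.IsBounded U) {w η : E → ℝ} (hw : HarmonicContOnCl w U)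
    (hw0 : ∀ y ∈ U, 0 ≤ w y) (hη : ContDiff ℝ 1 η) (hη0 : ∀ y, 0 ≤ η y)
    (hfr : ∀ y ∈ frontier U, w y = 0 ∨ y ∉ tsupport η) (hK : IsCompact K) (hKU : K ⊆ U)
    (hηK : ∀ y ∉ K, gradient η y = 0) :
    ∫ y, inner ℝ (gradient w y) (gradient η y) ∂μ ≤ 0 := by
  have hwc : ContinuousOn (gradient w) U := fun y hy =>
    ((hw.1 y hy).1.of_le (by norm_num)).continuousAt_gradient.continuousWithinAt
  have hηc : Continuous (gradient η) := continuous_iff_continuousAt.2 fun y =>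
    hη.contDiffAt.continuousAt_gradient
  have hIc : ContinuousOn (fun y => inner ℝ (gradient w y) (gradient η y)) U :=
    hwc.inner hηc.continuousOn
  have hI0 : ∀ y ∉ K, inner ℝ (gradient w y) (gradient η y) = 0 := fun y hy => by simp [hηK y hy]
  have hψc : ∀ k, ContinuousOn (fun y => valueCutoff k (w y)) U := fun k =>
    (contDiff_valueCutoff k).continuous.comp_continuousOn (hw.2.mono subset_closure)
  have hψI : ∀ k, Integrable
      (fun y => valueCutoff k (w y) * inner ℝ (gradient w y) (gradient η y)) μ := fun k =>
    integrable_of_continuousOn_of_support hK hKU ((hψc k).mul hIc) fun y hy => by simp [hI0 y hy]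
  have hkey : ∀ k, ∫ y, valueCutoff k (w y) * inner ℝ (gradient w y) (gradient η y) ∂μ ≤ 0 := by
    intro k
    -- The support stays away from the frontier: near one part of it `w` is too small for the value
    -- cutoff, near the rest `η` vanishes.
    set φ : E → ℝ := U.indicator fun y => η y * valueCutoff k (w y) with hφ
    set Kk : Set E := closure U ∩ w ⁻¹' (Ici (1 / (k + 1))) ∩ tsupport η with hKk
    have hk0 : (0 : ℝ) < k + 1 := by positivity
    have hKkc : IsCompact Kk := by
      have h1 : IsClosed (closure U ∩ w ⁻¹' (Ici (1 / ((k : ℝ) + 1)))) :=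
        hw.2.preimage_isClosed_of_isClosed isClosed_closure isClosed_Ici
      exact hUb.isCompact_closure.of_isClosed_subset (h1.inter (isClosed_tsupport η))
        fun y hy => hy.1.1
    have hKkU : Kk ⊆ U := by
      intro y hy
      by_contra hyU
      rcases hfr y ⟨hy.1.1, fun h => hyU (interior_subset h)⟩ with h | h
      · have h2 : 1 / ((k : ℝ) + 1) ≤ w y := hy.1.2
        rw [h] at h2
        exact absurd h2 (not_le.2 (by positivity))
      · exact h hy.2
    have hφ0 : ∀ y ∉ Kk, φ y = 0 := by
      intro y hy
      by_cases hyU : y ∈ U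
      · rw [hφ, indicator_of_mem hyU]
        by_cases hyη : y ∈ tsupport η
        · have : w y < 1 / (k + 1) := by
            by_contra! h
            exact hy ⟨⟨subset_closure hyU, h⟩, hyη⟩
          rw [valueCutoff_eq_zero, mul_zero]
          rw [lt_div_iff₀ hk0] at this
          linarith
        · rw [image_eq_zero_of_notMem_tsupport hyη, zero_mul]
      · rw [hφ, indicator_of_notMem hyU]
    have hφe : ∀ y ∈ U, φ =ᶠ[𝓝 y] fun y => η y * valueCutoff k (w y) := fun y hy => by
      filter_upwards [hUo.mem_nhds hy] with z hz using indicator_of_mem hz _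
    have hwd : ∀ y ∈ U, ContDiffAt ℝ 1 w y := fun y hy => (hw.1 y hy).1.of_le (by norm_num)
    have hφd : ∀ y ∈ U, ContDiffAt ℝ 1 φ y := fun y hy =>
      (hη.contDiffAt.mul ((contDiff_valueCutoff k).contDiffAt.comp y (hwd y hy))).congr_of_eventuallyEq
        (hφe y hy)
    have hz := hw.1.integral_inner_gradient_eq_zero (μ := μ) hφd hKkc hKkU hφ0
    have hφg0 : ∀ y ∉ Kk, gradient φ y = 0 := fun y hy =>
      gradient_eq_zero_iff_fderiv.2 (fderiv_eq_zero_of_notMem hKkc.isClosed hφ0 hy)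
    have hφgc : ContinuousOn (gradient φ) U := fun y hy =>
      (hφd y hy).continuousAt_gradient.continuousWithinAt
    -- By the product rule, ∇w·∇φ exceeds the integrand by η ψ'(w)|∇w|² ≥ 0, where ψ is the value
    -- cutoff, while its integral is zero.
    rw [← hz]
    refine integral_mono (hψI k) (integrable_of_continuousOn_of_support hKkc hKkU
      (hwc.inner hφgc) fun y hy => by simp [hφg0 y hy]) fun y => ?_
    by_cases hy : y ∈ U
    · have hψ' := ((contDiff_valueCutoff k).differentiable (by norm_num) (w y)).hasDerivAt
      have hfd := ((hη.differentiable (by norm_num) y).hasFDerivAt).mul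
        (hψ'.comp_hasFDerivAt y ((hwd y hy).differentiableAt (by norm_num)).hasFDerivAt)
      have hfd' : fderiv ℝ φ y = _ := (hfd.congr_of_eventuallyEq (hφe y hy)).fderiv
      have h1 : fderiv ℝ w y (gradient w y) = ‖gradient w y‖ ^ 2 := by
        rw [← real_inner_gradient_right, real_inner_self_eq_norm_sq]
      have h2 : 0 ≤ deriv (valueCutoff k) (w y) := (valueCutoff_monotone k).deriv_nonneg
      simp only [real_inner_gradient_right, hfd']
      simp only [add_apply, smul_apply, smul_eq_mul, h1,
        Function.comp_apply]
      have := mul_nonneg (hη0 y) (mul_nonneg h2 (sq_nonneg ‖gradient w y‖))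
      linarith
    · have hyK : y ∉ K := fun h => hy (hKU h)
      have hyK' : y ∉ Kk := fun h => hy (hKkU h)
      simp [hηK y hyK, hφg0 y hyK']
  refine le_of_tendsto' (tendsto_integral_of_dominated_convergence
    (F := fun k y => valueCutoff k (w y) * inner ℝ (gradient w y) (gradient η y))
    (fun y => ‖inner ℝ (gradient w y) (gradient η y)‖) (fun k => (hψI k).aestronglyMeasurable)
    (integrable_of_continuousOn_of_support hK hKU hIc hI0).norm (fun k => .of_forall fun y => ?_)
    (.of_forall fun y => ?_)) hkey
  · rw [norm_mul]
    refine mul_le_of_le_one_left (norm_nonneg _) ?_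
    rw [valueCutoff, Real.norm_of_nonneg (Real.smoothTransition.nonneg _)]
    exact Real.smoothTransition.le_one _
  · by_cases hy : y ∈ U
    -- The value cutoffs do not tend to 1 where `w` vanishes, but such points are minima, where the
    -- gradient is zero.
    · rcases (hw0 y hy).eq_or_lt with h | h
      · have hmin : IsLocalMin w y := by
          filter_upwards [hUo.mem_nhds hy] with z hz
          rw [← h]; exact hw0 z hz
        have : gradient w y = 0 := gradient_eq_zero_iff_fderiv.2 hmin.fderiv_eq_zero
        simp [this]
      · simpa using (tendsto_valueCutoff h).mul_const (inner ℝ (gradient w y) (gradient η y))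
    · have hyK : y ∉ K := fun h => hy (hKU h)
      simp [hηK y hyK]

end FluxSign

/-! ### Polar coordinates -/

section Polar

variable {E : Type*} [NormedAddCommGroup E] [InnerProductSpace ℝ E] [FiniteDimensional ℝ E]
  [MeasurableSpace E] [BorelSpace E] {μ : Measure E} [μ.IsAddHaarMeasure] [Nontrivial E]

/-- Integration in polar coordinates. -/
theorem integral_eq_integral_toSphere {f : E → ℝ} (hf : Integrable f μ) :
    ∫ y, f y ∂μ = ∫ r in Ioi (0 : ℝ), r ^ (Module.finrank ℝ E - 1) *
      ∫ θ : Metric.sphere (0 : E) 1, f (r • (θ : E)) ∂μ.toSphere := by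
  have hmp := μ.measurePreserving_homeomorphUnitSphereProd
  have hme := (homeomorphUnitSphereProd E).measurableEmbedding
  set F : Metric.sphere (0 : E) 1 × Ioi (0 : ℝ) → ℝ := fun p => f ((p.2 : ℝ) • (p.1 : E)) with hF
  have hcomp : (fun x : ({0}ᶜ : Set E) => f x) = F ∘ homeomorphUnitSphereProd E := by
    funext x
    have h : ((homeomorphUnitSphereProd E).symm (homeomorphUnitSphereProd E x) : E) = x := by simp
    rw [homeomorphUnitSphereProd_symm_apply_coe] at h
    simp only [hF, Function.comp_apply]
    rw [h]
  have hFi : Integrable F (μ.toSphere.prod (.volumeIoiPow (Module.finrank ℝ E - 1))) := by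
    rw [← hmp.integrable_comp_emb hme, ← hcomp]
    have := (hf.integrableOn (s := ({0}ᶜ : Set E)))
    rwa [integrableOn_iff_comap_subtypeVal (by measurability)] at this
  calc ∫ y, f y ∂μ = ∫ x : ({0}ᶜ : Set E), f x ∂(μ.comap (↑)) := by
        rw [integral_subtype_comap (measurableSet_singleton _).compl f, restrict_compl_singleton]
    _ = ∫ p, F p ∂(μ.toSphere.prod (.volumeIoiPow (Module.finrank ℝ E - 1))) := by
        rw [← hmp.integral_comp hme]; rw [hcomp]; rfl
    _ = ∫ r : Ioi (0 : ℝ), (∫ θ : Metric.sphere (0 : E) 1, f ((r : ℝ) • (θ : E)) ∂μ.toSphere)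
          ∂(.volumeIoiPow (Module.finrank ℝ E - 1)) := integral_prod_symm _ hFi
    _ = _ := by
        simp only [Measure.volumeIoiPow, ENNReal.ofReal]
        rw [integral_withDensity_eq_integral_smul, integral_subtype_comap measurableSet_Ioi
          fun a : ℝ => Real.toNNReal (a ^ (Module.finrank ℝ E - 1)) •
            ∫ θ : Metric.sphere (0 : E) 1, f (a • (θ : E)) ∂μ.toSphere]
        · refine setIntegral_congr_fun measurableSet_Ioi fun x hx => ?_
          simp only [NNReal.smul_def, Real.coe_toNNReal _ (pow_nonneg (le_of_lt hx) _), smul_eq_mul]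
        · exact (measurable_subtype_coe.pow_const _).real_toNNReal

omit [MeasurableSpace E] [BorelSpace E] [Nontrivial E] [FiniteDimensional ℝ E] in
theorem hasFDerivAt_norm_sub {x y : E} (h : y ≠ x) :
    HasFDerivAt (fun z => ‖z - x‖) (‖y - x‖⁻¹ • innerSL ℝ (y - x)) y := by
  have h0 : ‖y - x‖ ≠ 0 := norm_ne_zero_iff.2 (sub_ne_zero.2 h)
  have h1 := (((hasFDerivAt_id y).sub_const x).norm_sq).sqrt (by simpa using sub_ne_zero.2 h)
  have h2 : (fun z => √(‖id z - x‖ ^ 2)) = fun z => ‖z - x‖ := by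
    funext z; simp
  rw [h2] at h1
  convert h1 using 1
  ext v
  simp
  field_simp

omit [MeasurableSpace E] [BorelSpace E] [Nontrivial E] in
theorem inner_gradient_comp_norm {ρ : ℝ → ℝ} {x y v : E} (h : y ≠ x)
    (hρ : DifferentiableAt ℝ ρ ‖y - x‖) :
    inner ℝ v (gradient (fun z => ρ ‖z - x‖) y)
      = deriv ρ ‖y - x‖ * inner ℝ v (‖y - x‖⁻¹ • (y - x)) := by
  rw [real_inner_gradient_right]
  have := hρ.hasDerivAt.comp_hasFDerivAt y (hasFDerivAt_norm_sub h)
  rw [show (fun z => ρ ‖z - x‖) = ρ ∘ fun z => ‖z - x‖ from rfl, this.fderiv]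
  rw [real_inner_smul_right, real_inner_comm]
  simp [inner_sub_left]

/-- The flux integral of a vector field against a radial cutoff, in polar coordinates. -/
theorem integral_inner_gradient_comp_norm {V : E → E} {ρ : ℝ → ℝ} (hρ : Differentiable ℝ ρ) (x : E)
    (hI : Integrable (fun y => inner ℝ (V y) (gradient (fun z => ρ ‖z - x‖) y)) μ) :
    ∫ y, inner ℝ (V y) (gradient (fun z => ρ ‖z - x‖) y) ∂μ
      = ∫ r in Ioi (0 : ℝ), deriv ρ r * (r ^ (Module.finrank ℝ E - 1) *
        ∫ θ : Metric.sphere (0 : E) 1, inner ℝ (V (x + r • (θ : E))) (θ : E) ∂μ.toSphere) := by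
  have hI' : Integrable (fun y => inner ℝ (V (x + y)) (gradient (fun z => ρ ‖z - x‖) (x + y))) μ :=
    hI.comp_add_left x
  rw [← integral_add_left_eq_self _ x, integral_eq_integral_toSphere hI']
  refine setIntegral_congr_fun measurableSet_Ioi fun r (hr : 0 < r) => ?_
  rw [mul_left_comm]
  congr 1
  rw [← integral_const_mul]
  refine integral_congr_ae (.of_forall fun θ => ?_)
  have hθ : ‖(θ : E)‖ = 1 := by simp
  have hn : ‖x + r • (θ : E) - x‖ = r := by
    rw [add_sub_cancel_left, norm_smul, hθ, mul_one, Real.norm_of_nonneg hr.le]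
  have hne : x + r • (θ : E) ≠ x := by
    intro h
    rw [h, sub_self, norm_zero] at hn
    exact hr.ne hn
  simp only
  rw [inner_gradient_comp_norm hne (hρ _), hn, add_sub_cancel_left, smul_smul,
    inv_mul_cancel₀ hr.ne', one_smul]

end Polar

/-! ### Radial cutoffs on the line -/

section RadialCutoff

/-- A smooth radial profile which vanishes for `r ≤ ε + s` and equals `1` for `ε + 2 * s ≤ r`. -/
noncomputable def radialCutoff (ε s r : ℝ) : ℝ := Real.smoothTransition ((r - ε) / s - 1)

variable {ε s : ℝ}

theorem contDiff_radialCutoff : ContDiff ℝ 1 (radialCutoff ε s) :=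
  Real.smoothTransition.contDiff.comp (by fun_prop)

theorem radialCutoff_nonneg (r : ℝ) : 0 ≤ radialCutoff ε s r := Real.smoothTransition.nonneg _

theorem radialCutoff_eq_zero (hs : 0 < s) {r : ℝ} (hr : r ≤ ε + s) : radialCutoff ε s r = 0 := by
  refine Real.smoothTransition.zero_of_nonpos ?_
  rw [sub_nonpos, div_le_one hs]; linarith

theorem radialCutoff_eq_one (hs : 0 < s) {r : ℝ} (hr : ε + 2 * s ≤ r) : radialCutoff ε s r = 1 := by
  refine Real.smoothTransition.one_of_one_le ?_
  rw [le_sub_iff_add_le, le_div_iff₀ hs]; linarith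

theorem radialCutoff_monotone (hs : 0 < s) : Monotone (radialCutoff ε s) := fun a b h =>
  Real.smoothTransition.monotone (by gcongr)

theorem deriv_radialCutoff_nonneg (hs : 0 < s) (r : ℝ) : 0 ≤ deriv (radialCutoff ε s) r :=
  (radialCutoff_monotone hs).deriv_nonneg

theorem continuous_deriv_radialCutoff : Continuous (deriv (radialCutoff ε s)) :=
  contDiff_radialCutoff.continuous_deriv (by norm_num)

theorem deriv_radialCutoff_eq_zero (hs : 0 < s) {r : ℝ} (hr : r ∉ Icc (ε + s) (ε + 2 * s)) :
    deriv (radialCutoff ε s) r = 0 := by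
  rw [mem_Icc, not_and_or, not_le, not_le] at hr
  rcases hr with h | h
  · have : radialCutoff ε s =ᶠ[𝓝 r] fun _ => 0 := by
      filter_upwards [Iio_mem_nhds h] with t ht using radialCutoff_eq_zero hs (le_of_lt ht)
    rw [this.deriv_eq]; simp
  · have : radialCutoff ε s =ᶠ[𝓝 r] fun _ => 1 := by
      filter_upwards [Ioi_mem_nhds h] with t ht using radialCutoff_eq_one hs (le_of_lt ht)
    rw [this.deriv_eq]; simp

theorem integral_deriv_radialCutoff_mul (hε : 0 < ε) (hs : 0 < s) (Φ : ℝ → ℝ) :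
    ∫ r in Ioi (0 : ℝ), deriv (radialCutoff ε s) r * Φ r
      = ∫ r in ε..(ε + 2 * s), deriv (radialCutoff ε s) r * Φ r := by
  rw [intervalIntegral.integral_of_le (by linarith)]
  refine setIntegral_eq_of_subset_of_forall_sdiff_eq_zero measurableSet_Ioi
    (fun r hr => hε.trans hr.1) fun r hr => ?_
  rw [deriv_radialCutoff_eq_zero hs, zero_mul]
  intro h
  exact hr.2 ⟨by linarith [h.1], h.2⟩

theorem integral_deriv_radialCutoff (hs : 0 < s) :
    ∫ r in ε..(ε + 2 * s), deriv (radialCutoff ε s) r = 1 := by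
  rw [intervalIntegral.integral_deriv_eq_sub
    (fun r _ => contDiff_radialCutoff.differentiable (by norm_num) r)
    (continuous_deriv_radialCutoff.intervalIntegrable _ _),
    radialCutoff_eq_one hs le_rfl, radialCutoff_eq_zero hs (by linarith), sub_zero]

/-- The derivatives of the cutoffs are nonnegative, have integral one and live on [ε + s, ε + 2s]: a
one-sided approximate identity at ε, for which continuity of `Φ` from the right is enough. -/
theorem tendsto_integral_deriv_radialCutoff_mul {b : ℝ} (hε : 0 < ε) (hb : ε < b) {Φ : ℝ → ℝ}
    (hΦ : ContinuousOn Φ (Icc ε b)) :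
    Tendsto (fun s => ∫ r in Ioi (0 : ℝ), deriv (radialCutoff ε s) r * Φ r) (𝓝[>] 0)
      (𝓝 (Φ ε)) := by
  rw [Metric.tendsto_nhds]
  intro δ hδ
  obtain ⟨d, hd, hdΦ⟩ := Metric.continuousWithinAt_iff.1 (hΦ ε ⟨le_rfl, hb.le⟩) (δ / 2) (by positivity)
  have hpos : 0 < min (d / 4) ((b - ε) / 4) := by
    apply lt_min <;> linarith
  filter_upwards [Ioo_mem_nhdsGT hpos] with s hs
  have hs0 : 0 < s := hs.1
  have hs1 : s < d / 4 := hs.2.trans_le (min_le_left _ _)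
  have hs2 : s < (b - ε) / 4 := hs.2.trans_le (min_le_right _ _)
  have hle : ε ≤ ε + 2 * s := by linarith
  have hΦi : IntervalIntegrable (fun r => deriv (radialCutoff ε s) r * Φ r) volume ε (ε + 2 * s) := by
    refine ContinuousOn.intervalIntegrable ?_
    rw [uIcc_of_le hle]
    exact continuous_deriv_radialCutoff.continuousOn.mul
      (hΦ.mono (Icc_subset_Icc_right (by linarith)))
  have hci : IntervalIntegrable (fun r => deriv (radialCutoff ε s) r * Φ ε) volume ε (ε + 2 * s) :=
    (continuous_deriv_radialCutoff.mul continuous_const).intervalIntegrable _ _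
  have h1 : (∫ r in ε..(ε + 2 * s), deriv (radialCutoff ε s) r * Φ r) - Φ ε
      = ∫ r in ε..(ε + 2 * s), (deriv (radialCutoff ε s) r * Φ r
        - deriv (radialCutoff ε s) r * Φ ε) := by
    rw [intervalIntegral.integral_sub hΦi hci, intervalIntegral.integral_mul_const,
      integral_deriv_radialCutoff hs0, one_mul]
  rw [integral_deriv_radialCutoff_mul hε hs0, Real.dist_eq, h1, ← Real.norm_eq_abs]
  have h2 : ‖∫ r in ε..(ε + 2 * s), (deriv (radialCutoff ε s) r * Φ r
        - deriv (radialCutoff ε s) r * Φ ε)‖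
      ≤ ∫ r in ε..(ε + 2 * s), deriv (radialCutoff ε s) r * (δ / 2) := by
    refine intervalIntegral.norm_integral_le_of_norm_le hle (.of_forall fun r hr => ?_)
      ((continuous_deriv_radialCutoff.mul continuous_const).intervalIntegrable _ _)
    rw [← mul_sub, norm_mul, Real.norm_of_nonneg (deriv_radialCutoff_nonneg hs0 r)]
    refine mul_le_mul_of_nonneg_left (le_of_lt ?_) (deriv_radialCutoff_nonneg hs0 r)
    rw [← dist_eq_norm]
    refine hdΦ ⟨hr.1.le, by linarith [hr.2]⟩ ?_
    rw [Real.dist_eq, abs_of_nonneg (by linarith [hr.1])]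
    linarith [hr.2]
  rw [intervalIntegral.integral_mul_const, integral_deriv_radialCutoff hs0, one_mul] at h2
  linarith

end RadialCutoff

/-! ### Radial cutoffs in space -/

section RadialCutoffSpace

variable {E : Type*} [NormedAddCommGroup E] [InnerProductSpace ℝ E] {ε s : ℝ}

omit [InnerProductSpace ℝ E] in
theorem radialCutoff_eventuallyEq_zero (hs : 0 < s) {x y : E} (h : ‖y - x‖ < ε + s) :
    (fun z => radialCutoff ε s ‖z - x‖) =ᶠ[𝓝 y] fun _ => 0 := by
  have : ∀ᶠ z in 𝓝 y, ‖z - x‖ < ε + s :=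
    (by fun_prop : Continuous fun z => ‖z - x‖).continuousAt.eventually_lt_const h
  filter_upwards [this] with z hz using radialCutoff_eq_zero hs hz.le

theorem contDiff_radialCutoff_norm (hε : 0 < ε) (hs : 0 < s) (x : E) :
    ContDiff ℝ 1 fun z => radialCutoff ε s ‖z - x‖ := by
  rw [contDiff_iff_contDiffAt]
  intro y
  -- The norm is not smooth at the centre, but the cutoff vanishes identically near it.
  by_cases h : y = x
  · refine contDiffAt_const.congr_of_eventuallyEq (radialCutoff_eventuallyEq_zero hs ?_)
    rw [h, sub_self, norm_zero]; linarith
  · exact contDiff_radialCutoff.contDiffAt.comp y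
      ((contDiffAt_id.sub contDiffAt_const).norm ℝ (sub_ne_zero.2 h))

variable [FiniteDimensional ℝ E]

theorem gradient_radialCutoff_eq_zero (hs : 0 < s) {x y : E}
    (h : ¬ (ε + s ≤ ‖y - x‖ ∧ ‖y - x‖ ≤ ε + 2 * s)) :
    gradient (fun z => radialCutoff ε s ‖z - x‖) y = 0 := by
  rw [gradient_eq_zero_iff_fderiv]
  rw [not_and_or, not_le, not_le] at h
  rcases h with h | h
  · rw [(radialCutoff_eventuallyEq_zero hs h).fderiv_eq]; simp
  · have h1 : ∀ᶠ z in 𝓝 y, ε + 2 * s < ‖z - x‖ :=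
      (by fun_prop : Continuous fun z => ‖z - x‖).continuousAt.eventually_const_lt h
    have h2 : (fun z => radialCutoff ε s ‖z - x‖) =ᶠ[𝓝 y] fun _ => 1 := by
      filter_upwards [h1] with z hz using radialCutoff_eq_one hs hz.le
    rw [h2.fderiv_eq]; simp

theorem isCompact_annulus (x : E) (a b : ℝ) : IsCompact {y : E | a ≤ ‖y - x‖ ∧ ‖y - x‖ ≤ b} := by
  refine (isCompact_closedBall x b).of_isClosed_subset ?_ fun y hy => by
    simpa [dist_eq_norm] using hy.2
  have h : Continuous fun y : E => ‖y - x‖ := by fun_prop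
  exact (isClosed_le continuous_const h).inter (isClosed_le h continuous_const)

end RadialCutoffSpace

/-! ### Gradients and the geometry of the cored domain -/

section GradientAnnulus

variable {E : Type*} [NormedAddCommGroup E] [InnerProductSpace ℝ E] [FiniteDimensional ℝ E]

theorem gradient_sub_apply {f g : E → ℝ} {y : E} (hf : DifferentiableAt ℝ f y)
    (hg : DifferentiableAt ℝ g y) : gradient (f - g) y = gradient f y - gradient g y := by
  simp [gradient, fderiv_sub hf hg]

theorem gradient_add_apply {f g : E → ℝ} {y : E} (hf : DifferentiableAt ℝ f y)
    (hg : DifferentiableAt ℝ g y) : gradient (f + g) y = gradient f y + gradient g y := by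
  simp [gradient, fderiv_add hf hg]

theorem gradient_const_smul_apply {f : E → ℝ} {y : E} (c : ℝ) (hf : DifferentiableAt ℝ f y) :
    gradient (c • f) y = c • gradient f y := by
  simp [gradient, fderiv_const_smul hf]

theorem frontier_diff_closedBall_subset {D : Set E} {x : E} {ε : ℝ} :
    frontier (D \ Metric.closedBall x ε) ⊆ frontier D ∪ Metric.sphere x ε := by
  intro y hy
  have h := frontier_inter_subset D (Metric.closedBall x ε)ᶜ hy
  rcases h with h | h
  · exact Or.inl h.1
  · rw [frontier_compl] at h
    exact Or.inr (Metric.frontier_closedBall_subset_sphere h.2)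

theorem closure_diff_closedBall_subset {D : Set E} {x : E} {ε : ℝ} :
    closure (D \ Metric.closedBall x ε) ⊆ closure D \ Metric.ball x ε := by
  intro y hy
  refine ⟨closure_mono sdiff_subset hy, fun hb => ?_⟩
  obtain ⟨z, hz, hzD⟩ := mem_closure_iff.1 hy _ Metric.isOpen_ball hb
  exact hzD.2 (Metric.ball_subset_closedBall hz)

theorem eventually_closedBall_add_subset {D : Set E} (hD : IsOpen D) {x : E} {ε : ℝ} (hε : 0 < ε)
    (h : Metric.closedBall x ε ⊆ D) :
    ∀ᶠ s in 𝓝[>] (0 : ℝ), Metric.closedBall x (ε + 2 * s) ⊆ D := by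
  obtain ⟨δ, hδ, hsub⟩ := (isCompact_closedBall x ε).exists_cthickening_subset_open hD h
  rw [cthickening_closedBall hδ.le hε.le] at hsub
  filter_upwards [Ioo_mem_nhdsGT (show (0 : ℝ) < δ / 2 by positivity)] with s hs
  exact (Metric.closedBall_subset_closedBall (by linarith [hs.2])).trans hsub

theorem annulus_subset {D : Set E} {x : E} {ε s : ℝ} (hs : 0 < s)
    (h : Metric.closedBall x (ε + 2 * s) ⊆ D) :
    {y : E | ε + s ≤ ‖y - x‖ ∧ ‖y - x‖ ≤ ε + 2 * s} ⊆ D \ Metric.closedBall x ε := by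
  intro y hy
  refine ⟨h (by simpa [dist_eq_norm] using hy.2), fun hb => ?_⟩
  rw [Metric.mem_closedBall, dist_eq_norm] at hb
  linarith [hy.1]

theorem InnerProductSpace.HarmonicOnNhd.continuousOn_gradient {U : Set E} {w : E → ℝ}
    (hw : HarmonicOnNhd w U) : ContinuousOn (gradient w) U := fun y hy =>
  ((hw y hy).1.of_le (by norm_num)).continuousAt_gradient.continuousWithinAt

end GradientAnnulus

/-! ### Fluxes as limits over annuli, and their monotonicity -/

section FluxComparison

variable {E : Type*} [NormedAddCommGroup E] [InnerProductSpace ℝ E] [FiniteDimensional ℝ E]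
  [MeasurableSpace E] [BorelSpace E] {μ : Measure E} [μ.IsAddHaarMeasure] {D : Set E} {x : E}
  {ε s : ℝ}

theorem integrable_inner_gradient_radialCutoff (hε : 0 < ε) (hs : 0 < s)
    (h : Metric.closedBall x (ε + 2 * s) ⊆ D) {V : E → E}
    (hV : ContinuousOn V (D \ Metric.closedBall x ε)) :
    Integrable (fun y => inner ℝ (V y) (gradient (fun z => radialCutoff ε s ‖z - x‖) y)) μ :=
  integrable_of_continuousOn_of_support (isCompact_annulus x (ε + s) (ε + 2 * s))
    (annulus_subset hs h) (hV.inner (continuous_iff_continuousAt.2 fun y =>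
      (contDiff_radialCutoff_norm hε hs x).contDiffAt.continuousAt_gradient).continuousOn)
    fun y hy => by rw [gradient_radialCutoff_eq_zero hs hy, inner_zero_right]

/-- The flux through a sphere is monotone in the values on the sphere, for harmonic functions with
the same values on the outer boundary. -/
theorem integral_inner_gradient_radialCutoff_le [Nontrivial E] (hDo : IsOpen D)
    (hDb : Bornology.IsBounded D)
    (hε : 0 < ε) (hs : 0 < s) (h : Metric.closedBall x (ε + 2 * s) ⊆ D) {w₁ w₂ : E → ℝ}
    (h₁ : HarmonicContOnCl w₁ (D \ Metric.closedBall x ε))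
    (h₂ : HarmonicContOnCl w₂ (D \ Metric.closedBall x ε))
    (hsph : ∀ y ∈ Metric.sphere x ε, w₁ y ≤ w₂ y) (hfr : ∀ y ∈ frontier D, w₁ y = w₂ y) :
    ∫ y, inner ℝ (gradient w₂ y) (gradient (fun z => radialCutoff ε s ‖z - x‖) y) ∂μ
      ≤ ∫ y, inner ℝ (gradient w₁ y) (gradient (fun z => radialCutoff ε s ‖z - x‖) y) ∂μ := by
  have hUo : IsOpen (D \ Metric.closedBall x ε) := hDo.sdiff Metric.isClosed_closedBall
  have hUb : Bornology.IsBounded (D \ Metric.closedBall x ε) := hDb.subset sdiff_subset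
  have hw := h₂.sub h₁
  have hle := h₁.le_of_frontier hUo hUb h₂ fun y hy => by
    rcases frontier_diff_closedBall_subset hy with hy | hy
    exacts [(hfr y hy).le, hsph y hy]
  have hflux := hw.integral_inner_gradient_nonpos (μ := μ) hUo hUb
    (fun y hy => sub_nonneg.2 (hle y (subset_closure hy))) (contDiff_radialCutoff_norm hε hs x)
    (fun y => radialCutoff_nonneg _) (fun y hy => by
      rcases frontier_diff_closedBall_subset hy with hy | hy
      · exact Or.inl (by simp [hfr y hy])
      -- The difference need not vanish on the sphere, but the cutoff is zero up to radius ε + s.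
      · refine Or.inr (notMem_tsupport_iff_eventuallyEq.2 (radialCutoff_eventuallyEq_zero hs ?_))
        rw [mem_sphere_iff_norm.1 hy]; linarith)
    (isCompact_annulus x (ε + s) (ε + 2 * s)) (annulus_subset hs h)
    fun y hy => gradient_radialCutoff_eq_zero hs hy
  have hI₁ := integrable_inner_gradient_radialCutoff (μ := μ) hε hs h h₁.1.continuousOn_gradient
  have hI₂ := integrable_inner_gradient_radialCutoff (μ := μ) hε hs h h₂.1.continuousOn_gradient
  rw [← sub_nonpos, ← integral_sub hI₂ hI₁]
  refine le_of_eq_of_le (integral_congr_ae (.of_forall fun y => ?_)) hflux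
  beta_reduce
  by_cases hy : ε + s ≤ ‖y - x‖ ∧ ‖y - x‖ ≤ ε + 2 * s
  · have hyU := annulus_subset hs h hy
    rw [gradient_sub_apply (h₂.differentiableAt hyU) (h₁.differentiableAt hyU), inner_sub_left]
  · simp [gradient_radialCutoff_eq_zero hs hy]

/-- Including the endpoint ε is the point: there the continuous extension `g` of the gradient is
used, and it identifies the limit over thin annuli with the flux. -/
theorem continuousOn_integral_sphere {g : E → E} {b : ℝ} (hε : 0 < ε)
    (hg : ContinuousOn g (Metric.closedBall x b \ Metric.ball x ε)) (k : ℕ) :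
    ContinuousOn (fun r : ℝ => r ^ k * ∫ θ : Metric.sphere (0 : E) 1,
      inner ℝ (g (x + r • (θ : E))) (θ : E) ∂μ.toSphere) (Icc ε b) := by
  refine (continuous_pow k).continuousOn.mul ?_
  rw [continuousOn_iff_continuous_domRestrict]
  refine (continuous_parametric_integral_of_continuous (μ := μ.toSphere) (s := univ)
    (f := fun (r : Icc ε b) (θ : Metric.sphere (0 : E) 1) =>
      inner ℝ (g (x + (r : ℝ) • (θ : E))) (θ : E)) ?_ isCompact_univ).congr fun r => ?_
  · have hmaps : ∀ p : Icc ε b × Metric.sphere (0 : E) 1,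
        x + (p.1 : ℝ) • (p.2 : E) ∈ Metric.closedBall x b \ Metric.ball x ε := by
      rintro ⟨r, θ⟩
      have h0 : 0 ≤ (r : ℝ) := hε.le.trans r.2.1
      have h1 : ‖(r : ℝ) • (θ : E)‖ = r := by
        rw [norm_smul, Real.norm_of_nonneg h0]; simp
      simp only [Set.mem_sdiff, Metric.mem_closedBall, Metric.mem_ball, dist_eq_norm,
        add_sub_cancel_left, h1, not_lt]
      exact ⟨r.2.2, r.2.1⟩
    have h2 : Continuous fun p : Icc ε b × Metric.sphere (0 : E) 1 =>
        x + (p.1 : ℝ) • (p.2 : E) := by fun_prop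
    exact (hg.comp_continuous h2 hmaps).inner (by fun_prop)
  · simp

/-- The flux through a sphere as the limit of integrals over thin annuli. -/
theorem tendsto_integral_inner_gradient_radialCutoff [Nontrivial E] (hDo : IsOpen D) (hε : 0 < ε)
    (h : Metric.closedBall x ε ⊆ D) {u : E → ℝ} {g : E → E}
    (hg : ContinuousOn g (D \ Metric.ball x ε))
    (hgu : ∀ y ∈ D \ Metric.closedBall x ε, g y = gradient u y) :
    Tendsto (fun s => ∫ y, inner ℝ (gradient u y)
        (gradient (fun z => radialCutoff ε s ‖z - x‖) y) ∂μ) (𝓝[>] 0)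
      (𝓝 (ε ^ (Module.finrank ℝ E - 1) * ∫ θ : Metric.sphere (0 : E) 1,
        inner ℝ (g (x + ε • (θ : E))) (θ : E) ∂μ.toSphere)) := by
  obtain ⟨s₀, hs₀, hs₀0⟩ := ((eventually_closedBall_add_subset hDo hε h).and self_mem_nhdsWithin).exists
  have hs₀0 : 0 < s₀ := hs₀0
  have hlim := tendsto_integral_deriv_radialCutoff_mul hε (by linarith : ε < ε + 2 * s₀)
    (continuousOn_integral_sphere (μ := μ) hε (hg.mono (sdiff_subset_sdiff_left hs₀))
      (Module.finrank ℝ E - 1))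
  refine hlim.congr' ?_
  filter_upwards [eventually_closedBall_add_subset hDo hε h, self_mem_nhdsWithin] with s hs (hs0 : 0 < s)
  have hcg : ContinuousOn g (D \ Metric.closedBall x ε) :=
    hg.mono (sdiff_subset_sdiff_right Metric.ball_subset_closedBall)
  rw [← integral_inner_gradient_comp_norm (contDiff_radialCutoff.differentiable (by norm_num)) x
    (integrable_inner_gradient_radialCutoff hε hs0 hs hcg)]
  refine integral_congr_ae (.of_forall fun y => ?_)
  beta_reduce
  by_cases hy : ε + s ≤ ‖y - x‖ ∧ ‖y - x‖ ≤ ε + 2 * s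
  · rw [hgu y (annulus_subset hs0 hs hy)]
  · simp [gradient_radialCutoff_eq_zero hs0 hy]

/-- A function harmonic across the ball has no flux through its sphere. -/
theorem integral_inner_gradient_radialCutoff_eq_zero (hε : 0 < ε) (hs : 0 < s)
    (h : Metric.closedBall x (ε + 2 * s) ⊆ D) {v : E → ℝ} (hv : HarmonicOnNhd v D) :
    ∫ y, inner ℝ (gradient v y) (gradient (fun z => radialCutoff ε s ‖z - x‖) y) ∂μ = 0 := by
  have hη := contDiff_radialCutoff_norm hε hs x
  -- One minus the cutoff has compact support in `D`, and its gradient is minus that of the cutoff.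
  have hz := hv.integral_inner_gradient_eq_zero (μ := μ)
    (φ := (fun _ => 1) - fun z => radialCutoff ε s ‖z - x‖)
    (fun y _ => (contDiff_const.sub hη).contDiffAt) (isCompact_closedBall x (ε + 2 * s)) h
    fun y hy => by
      rw [Metric.mem_closedBall, not_le, dist_eq_norm] at hy
      simp [radialCutoff_eq_one hs hy.le]
  rw [← neg_eq_zero, ← integral_neg, ← hz]
  refine integral_congr_ae (.of_forall fun y => ?_)
  beta_reduce
  rw [gradient_sub_apply (differentiableAt_const _) (hη.differentiable (by norm_num) y)]
  simp [gradient]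

end FluxComparison

/-! ### The singular part of the Green's function -/

section GreenSingularity

/-- The factor `γ` in `(greenSingularity n)' r = -γ / r ^ (n - 1)`. -/
noncomputable def greenSlope (n : ℕ) : ℝ := if n = 2 then 1 else (n : ℝ) - 2

theorem greenSlope_pos {n : ℕ} (hn : 2 ≤ n) : 0 < greenSlope n := by
  unfold greenSlope
  split_ifs with h
  · exact one_pos
  · have : (3 : ℝ) ≤ n := by exact_mod_cast (by omega : 3 ≤ n)
    linarith

/-- Written with r · r⁻ⁿ, the derivative has no truncated exponent and both dimension cases share
one formula; the gradient becomes -γ (y - x) / |y - x|ⁿ with γ the slope constant. -/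
theorem hasDerivAt_greenSingularity {n : ℕ} (hn : 2 ≤ n) {r : ℝ} (hr : 0 < r) :
    HasDerivAt (greenSingularity n) (-greenSlope n * r * (r ^ n)⁻¹) r := by
  rcases hn.eq_or_lt with rfl | h
  · have h1 : greenSingularity 2 = fun r => -Real.log r := by
      funext r; simp [greenSingularity]
    rw [h1]
    refine (Real.hasDerivAt_log hr.ne').neg.congr_deriv ?_
    simp only [greenSlope, if_true]
    field_simp
  · obtain ⟨k, rfl⟩ : ∃ k, n = k + 3 := ⟨n - 3, by omega⟩
    have h1 : greenSingularity (k + 3) = fun r => (r ^ (k + 1))⁻¹ := by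
      funext r; simp [greenSingularity]
    rw [h1]
    refine ((hasDerivAt_pow (k + 1) r).inv (by positivity)).congr_deriv ?_
    simp only [greenSlope, show k + 3 ≠ 2 by omega, if_false]
    push_cast
    field_simp
    ring

theorem contDiffAt_greenSingularity {n : ℕ} {r : ℝ} (hr : 0 < r) {m : WithTop ℕ∞} :
    ContDiffAt ℝ m (greenSingularity n) r := by
  have h1 : ContDiffAt ℝ m (fun r : ℝ => Real.log (1 / r)) r :=
    ContDiffAt.log (contDiffAt_const.div contDiffAt_id hr.ne') (by positivity)
  have h2 : ContDiffAt ℝ m (fun r : ℝ => 1 / r ^ (n - 2)) r :=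
    contDiffAt_const.div (contDiffAt_id.pow _) (by positivity)
  unfold greenSingularity
  by_cases h : n = 2
  · simpa [h] using h1
  · simpa [h] using h2

theorem greenSingularity_strictAntiOn {n : ℕ} (hn : 2 ≤ n) :
    StrictAntiOn (greenSingularity n) (Ioi 0) := by
  refine strictAntiOn_of_deriv_neg (convex_Ioi 0)
    (fun r hr => (hasDerivAt_greenSingularity hn hr).continuousAt.continuousWithinAt) fun r hr => ?_
  rw [interior_Ioi] at hr
  have hr : 0 < r := hr
  rw [(hasDerivAt_greenSingularity hn hr).deriv]
  have := greenSlope_pos hn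
  rw [neg_mul, neg_mul, neg_lt_zero]
  positivity

theorem tendsto_greenSingularity {n : ℕ} (hn : 2 ≤ n) :
    Tendsto (greenSingularity n) (𝓝[>] 0) atTop := by
  rcases hn.eq_or_lt with rfl | h
  · have h1 : greenSingularity 2 = fun r => -Real.log r := by
      funext r; simp [greenSingularity]
    rw [h1]
    exact tendsto_neg_atBot_atTop.comp Real.tendsto_log_nhdsGT_zero
  · obtain ⟨k, rfl⟩ : ∃ k, n = k + 3 := ⟨n - 3, by omega⟩
    have h1 : greenSingularity (k + 3) = fun r => (r ^ (k + 1))⁻¹ := by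
      funext r; simp [greenSingularity]
    rw [h1]
    refine tendsto_inv_nhdsGT_zero.comp (tendsto_nhdsWithin_iff.2 ⟨?_, ?_⟩)
    · have : Tendsto (fun r : ℝ => r ^ (k + 1)) (𝓝 0) (𝓝 (0 ^ (k + 1))) :=
        (continuous_pow _).tendsto _
      rw [zero_pow (by omega)] at this
      exact this.mono_left nhdsWithin_le_nhds
    · filter_upwards [self_mem_nhdsWithin] with r (hr : 0 < r)
      exact pow_pos hr _

variable {E : Type*} [NormedAddCommGroup E] [InnerProductSpace ℝ E] [FiniteDimensional ℝ E] {n : ℕ}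

theorem fderiv_greenSingularity (hn : 2 ≤ n) {x y : E} (h : y ≠ x) (e : E) :
    fderiv ℝ (fun z => greenSingularity n ‖z - x‖) y e
      = -greenSlope n * ((‖y - x‖ ^ n)⁻¹ * inner ℝ (y - x) e) := by
  have h0 : 0 < ‖y - x‖ := norm_pos_iff.2 (sub_ne_zero.2 h)
  have := (hasDerivAt_greenSingularity hn h0).comp_hasFDerivAt y (hasFDerivAt_norm_sub h)
  rw [show (fun z => greenSingularity n ‖z - x‖) = greenSingularity n ∘ fun z => ‖z - x‖ from rfl,
    this.fderiv]
  simp only [smul_apply, innerSL_apply_apply, smul_eq_mul]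
  field_simp

theorem contDiffAt_greenSingularity_norm {x y : E} (h : y ≠ x) {m : WithTop ℕ∞} :
    ContDiffAt ℝ m (fun z => greenSingularity n ‖z - x‖) y :=
  (contDiffAt_greenSingularity (norm_pos_iff.2 (sub_ne_zero.2 h))).comp y
    ((contDiffAt_id.sub contDiffAt_const).norm ℝ (sub_ne_zero.2 h))

/-- The singularity of the Green's function is harmonic away from the pole. -/
theorem harmonicAt_greenSingularity (hn : 2 ≤ n) (hdim : Module.finrank ℝ E = n) {x y : E}
    (h : y ≠ x) : HarmonicAt (fun z => greenSingularity n ‖z - x‖) y := by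
  refine ⟨contDiffAt_greenSingularity_norm h, ?_⟩
  filter_upwards [isOpen_ne.mem_nhds h] with p hp
  have h0 : 0 < ‖p - x‖ := norm_pos_iff.2 (sub_ne_zero.2 hp)
  have key : ∀ e : E, ‖e‖ = 1 → iteratedFDeriv ℝ 2 (fun z => greenSingularity n ‖z - x‖) p ![e, e]
      = -greenSlope n * ((‖p - x‖ ^ n)⁻¹
        - n * inner ℝ (p - x) e ^ 2 * (‖p - x‖ ^ n)⁻¹ / ‖p - x‖ ^ 2) := by
    intro e he
    refine iteratedFDeriv_two_eq_of_hasDerivAt (contDiffAt_greenSingularity_norm hp)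
      (q := fun z => -greenSlope n * ((‖z - x‖ ^ n)⁻¹ * inner ℝ (z - x) e)) ?_ ?_
    · filter_upwards [isOpen_ne.mem_nhds hp] with z hz using fderiv_greenSingularity hn hz e
    · have hN : HasDerivAt (fun t : ℝ => ‖p + t • e - x‖) (‖p - x‖⁻¹ * inner ℝ (p - x) e) 0 := by
        have := (hasFDerivAt_norm_sub hp).hasLineDerivAt e
        simpa [HasLineDerivAt, inner_sub_left] using this
      have hi : HasDerivAt (fun t : ℝ => inner ℝ (p + t • e - x) e) 1 0 := by
        have h1 : (fun t : ℝ => inner ℝ (p + t • e - x) e) = fun t => inner ℝ (p - x) e + t := by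
          funext t
          rw [show p + t • e - x = (p - x) + t • e by abel, inner_add_left, real_inner_smul_left,
            real_inner_self_eq_norm_sq, he]
          ring
        rw [h1]
        exact (hasDerivAt_id _).const_add _
      have hN0 : ‖p + (0 : ℝ) • e - x‖ = ‖p - x‖ := by simp
      refine ((((hN.pow n).inv (by rw [Pi.pow_apply, hN0]; positivity)).mul hi).const_mul
        (-greenSlope n)).congr_deriv ?_
      simp only [Pi.pow_apply, zero_smul, add_zero, Pi.inv_apply]
      obtain ⟨k, rfl⟩ : ∃ k, n = k + 1 := ⟨n - 1, by omega⟩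
      simp only [add_tsub_cancel_right]
      field_simp
      ring
  rw [laplacian_eq_iteratedFDeriv_stdOrthonormalBasis]
  simp only [Pi.zero_apply]
  rw [Finset.sum_congr rfl fun i _ => key _ ((stdOrthonormalBasis ℝ E).orthonormal.1 i)]
  -- Parseval: the squared components sum to |p - x|², so the two parts of `key` contribute n - n =
  -- 0.
  have hsum : ∑ i, inner ℝ (p - x) (stdOrthonormalBasis ℝ E i) ^ 2 = ‖p - x‖ ^ 2 := by
    rw [← real_inner_self_eq_norm_sq, ← (stdOrthonormalBasis ℝ E).sum_inner_mul_inner]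
    exact Finset.sum_congr rfl fun i _ => by rw [sq, real_inner_comm (p - x)]
  rw [← Finset.mul_sum, Finset.sum_sub_distrib, ← Finset.sum_div, ← Finset.sum_mul,
    ← Finset.mul_sum, hsum]
  simp only [Finset.sum_const, Finset.card_univ, Fintype.card_fin, hdim, nsmul_eq_mul]
  field_simp
  simp

variable [Nontrivial E] [MeasurableSpace E] [BorelSpace E] {μ : Measure E} [μ.IsAddHaarMeasure]

/-- The flux of the Green's function through a sphere about its pole. -/
theorem integral_inner_gradient_greenSingularity (hn : 2 ≤ n) (hdim : Module.finrank ℝ E = n)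
    {x : E} {ε s : ℝ} (hε : 0 < ε) (hs : 0 < s) :
    ∫ y, inner ℝ (gradient (fun z => greenSingularity n ‖z - x‖) y)
        (gradient (fun z => radialCutoff ε s ‖z - x‖) y) ∂μ
      = -(greenSlope n * μ.toSphere.real univ) := by
  have hc : ContinuousOn (gradient fun z => greenSingularity n ‖z - x‖)
      (univ \ Metric.closedBall x ε) := fun y hy => by
    refine (contDiffAt_greenSingularity_norm ?_).continuousAt_gradient.continuousWithinAt
    rintro rfl
    exact hy.2 (Metric.mem_closedBall_self hε.le)
  rw [integral_inner_gradient_comp_norm (contDiff_radialCutoff.differentiable (by norm_num)) x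
    (integrable_inner_gradient_radialCutoff hε hs (subset_univ _) hc)]
  -- The radial derivative decays exactly like r^(1-n), so the flux through a sphere is independent
  -- of its radius.
  have hΦ : ∀ r ∈ Ioi (0 : ℝ), deriv (radialCutoff ε s) r * (r ^ (Module.finrank ℝ E - 1) *
      ∫ θ : Metric.sphere (0 : E) 1, inner ℝ (gradient (fun z => greenSingularity n ‖z - x‖)
        (x + r • (θ : E))) (θ : E) ∂μ.toSphere)
      = deriv (radialCutoff ε s) r * (-(greenSlope n * μ.toSphere.real univ)) := by
    intro r hr
    have hr : 0 < r := hr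
    congr 1
    have h1 : ∀ θ : Metric.sphere (0 : E) 1, inner ℝ (gradient (fun z => greenSingularity n ‖z - x‖)
        (x + r • (θ : E))) (θ : E) = -greenSlope n * ((r ^ n)⁻¹ * r) := by
      intro θ
      have hθ : ‖(θ : E)‖ = 1 := by simp
      have hne : x + r • (θ : E) ≠ x := by
        intro h
        have h2 : r • (θ : E) = 0 := by simpa using h
        have h3 : ‖r • (θ : E)‖ = 0 := by rw [h2, norm_zero]
        rw [norm_smul, hθ, mul_one, Real.norm_of_nonneg hr.le] at h3
        exact hr.ne' h3
      rw [real_inner_comm, real_inner_gradient_right, fderiv_greenSingularity hn hne,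
        add_sub_cancel_left, norm_smul, hθ, real_inner_smul_left, real_inner_self_eq_norm_sq, hθ,
        Real.norm_of_nonneg hr.le]
      simp
    simp_rw [h1]
    rw [integral_const, hdim, smul_eq_mul]
    obtain ⟨k, rfl⟩ : ∃ k, n = k + 1 := ⟨n - 1, by omega⟩
    simp only [add_tsub_cancel_right]
    field_simp
    ring
  rw [setIntegral_congr_fun measurableSet_Ioi hΦ,
    integral_deriv_radialCutoff_mul hε hs (fun _ => -(greenSlope n * μ.toSphere.real univ)),
    intervalIntegral.integral_mul_const, integral_deriv_radialCutoff hs, one_mul]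

end GreenSingularity

/-! ### Bounds for the flux by the Green's function -/

section FluxBounds

variable {n : ℕ} {D : Set (EuclideanSpace ℝ (Fin n))} {x : EuclideanSpace ℝ (Fin n)} {ε F : ℝ}
  {v : EuclideanSpace ℝ (Fin n) → ℝ}

theorem nontrivial_euclideanSpace (hn : 2 ≤ n) : Nontrivial (EuclideanSpace ℝ (Fin n)) :=
  Module.nontrivial_of_finrank_pos (R := ℝ) (by rw [finrank_euclideanSpace_fin]; omega)

/-- The flux of the Green's function. -/
noncomputable def greenFlux (n : ℕ) : ℝ :=
  greenSlope n * (volume : Measure (EuclideanSpace ℝ (Fin n))).toSphere.real univ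

theorem greenFlux_pos (hn : 2 ≤ n) : 0 < greenFlux n := by
  have := nontrivial_euclideanSpace hn
  refine mul_pos (greenSlope_pos hn) ?_
  rw [measureReal_def, ENNReal.toReal_pos_iff]
  exact ⟨pos_iff_ne_zero.2 fun h => Measure.toSphere_ne_zero _ (Measure.measure_univ_eq_zero.1 h),
    measure_lt_top _ _⟩

/-- The Green's function with pole `x`, on the complement of a ball about `x`. -/
theorem IsGreenRegularPart.harmonicContOnCl (hn : 2 ≤ n) (hε : 0 < ε)
    (hv : IsGreenRegularPart D x v) :
    HarmonicContOnCl ((fun z => greenSingularity n ‖z - x‖) + v) (D \ Metric.closedBall x ε) := by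
  refine HarmonicContOnCl.add ⟨fun y hy => harmonicAt_greenSingularity hn (by simp) ?_,
    fun y hy => ((contDiffAt_greenSingularity_norm (m := 0) ?_).continuousAt).continuousWithinAt⟩
    (hv.1.mono sdiff_subset)
  · rintro rfl
    exact hy.2 (Metric.mem_closedBall_self hε.le)
  · rintro rfl
    exact (closure_diff_closedBall_subset hy).2 (Metric.mem_ball_self hε)

theorem IsFlux.tendsto (hn : 2 ≤ n) (hDo : IsOpen D) {u : EuclideanSpace ℝ (Fin n) → ℝ}
    {g : EuclideanSpace ℝ (Fin n) → EuclideanSpace ℝ (Fin n)} (hε : 0 < ε)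
    (hb : Metric.closedBall x ε ⊆ D) (hg : IsGradientUpToSphere D ε x u g) :
    Tendsto (fun s => ∫ y, inner ℝ (gradient u y)
        (gradient (fun z => radialCutoff ε s ‖z - x‖) y)) (𝓝[>] 0)
      (𝓝 (-sphereFlux ε x g)) := by
  have := nontrivial_euclideanSpace hn
  have h := tendsto_integral_inner_gradient_radialCutoff (μ := volume) hDo hε hb hg.1 hg.2
  rw [finrank_euclideanSpace_fin] at h
  rw [sphereFlux, neg_neg]
  exact h

/-- The zero function has no flux and lies below the potential on the sphere, so this is a case of
flux monotonicity. -/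
theorem IsFlux.nonneg (hn : 2 ≤ n) (hDo : IsOpen D) (hDb : Bornology.IsBounded D)
    (hF : IsFlux D ε x F) : 0 ≤ F := by
  have := nontrivial_euclideanSpace hn
  obtain ⟨hε, hb, u, g, hu, hg, rfl⟩ := hF
  rw [← neg_nonpos]
  refine le_of_tendsto (IsFlux.tendsto hn hDo hε hb hg) ?_
  filter_upwards [eventually_closedBall_add_subset hDo hε hb, self_mem_nhdsWithin] with s hs hs0
  refine (integral_inner_gradient_radialCutoff_le hDo hDb hε hs0 hs
    (w₁ := fun _ => 0) harmonicContOnCl_const hu.1 (fun y hy => by simp [hu.2.1 y hy])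
    fun y hy => by simp [hu.2.2 y hy]).trans_eq ?_
  simp [gradient]

/-- All the flux comes from the singularity: the regular part is harmonic across the ball and
contributes nothing. -/
theorem integral_inner_gradient_greenFunction (hn : 2 ≤ n) (hε : 0 < ε)
    (hv : IsGreenRegularPart D x v) {s : ℝ} (hs : 0 < s)
    (h : Metric.closedBall x (ε + 2 * s) ⊆ D) :
    ∫ y, inner ℝ (gradient ((fun z => greenSingularity n ‖z - x‖) + v) y)
        (gradient (fun z => radialCutoff ε s ‖z - x‖) y) = -greenFlux n := by
  have := nontrivial_euclideanSpace hn
  have hG : HarmonicOnNhd (fun z => greenSingularity n ‖z - x‖) (D \ Metric.closedBall x ε) := by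
    intro y hy
    refine harmonicAt_greenSingularity hn (by simp) ?_
    rintro rfl
    exact hy.2 (Metric.mem_closedBall_self hε.le)
  have hv' : HarmonicOnNhd v (D \ Metric.closedBall x ε) := hv.1.1.mono sdiff_subset
  have h1 := integral_inner_gradient_greenSingularity (μ := volume) hn
    (finrank_euclideanSpace_fin (𝕜 := ℝ)) (x := x) hε hs
  have h2 := integral_inner_gradient_radialCutoff_eq_zero (μ := volume) hε hs h hv.1.1
  have hsum := integral_add
    (integrable_inner_gradient_radialCutoff (μ := volume) hε hs h hG.continuousOn_gradient)
    (integrable_inner_gradient_radialCutoff (μ := volume) hε hs h hv'.continuousOn_gradient)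
  rw [h1, h2, add_zero] at hsum
  rw [greenFlux, ← hsum]
  refine integral_congr_ae (.of_forall fun y => ?_)
  beta_reduce
  by_cases hy : ε + s ≤ ‖y - x‖ ∧ ‖y - x‖ ≤ ε + 2 * s
  · have hyU := annulus_subset hs h hy
    rw [gradient_add_apply ((hG y hyU).1.differentiableAt (by norm_num))
      ((hv' y hyU).1.differentiableAt (by norm_num)), inner_add_left]
  · simp [gradient_radialCutoff_eq_zero hs hy]

theorem integral_inner_gradient_const_smul {u : EuclideanSpace ℝ (Fin n) → ℝ} {s : ℝ}
    (hs : 0 < s)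
    (h : Metric.closedBall x (ε + 2 * s) ⊆ D) (hu : HarmonicOnNhd u (D \ Metric.closedBall x ε))
    (c : ℝ) :
    ∫ y, inner ℝ (gradient (c • u) y) (gradient (fun z => radialCutoff ε s ‖z - x‖) y)
      = c * ∫ y, inner ℝ (gradient u y) (gradient (fun z => radialCutoff ε s ‖z - x‖) y) := by
  rw [← integral_const_mul]
  refine integral_congr_ae (.of_forall fun y => ?_)
  beta_reduce
  by_cases hy : ε + s ≤ ‖y - x‖ ∧ ‖y - x‖ ≤ ε + 2 * s
  · rw [gradient_const_smul_apply _
      ((hu y (annulus_subset hs h hy)).1.differentiableAt (by norm_num)), real_inner_smul_left]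
  · simp [gradient_radialCutoff_eq_zero hs hy]

/-- A lower bound for the flux, from an upper bound for the Green's function on the sphere. -/
theorem IsFlux.greenFlux_le (hn : 2 ≤ n) (hDo : IsOpen D) (hDb : Bornology.IsBounded D)
    (hF : IsFlux D ε x F) (hv : IsGreenRegularPart D x v) {M : ℝ}
    (hM : ∀ y ∈ Metric.sphere x ε, greenSingularity n ε + v y ≤ M) : greenFlux n ≤ M * F := by
  have := nontrivial_euclideanSpace hn
  obtain ⟨hε, hb, u, g, hu, hg, rfl⟩ := hF
  have hlim := (IsFlux.tendsto hn hDo hε hb hg).const_mul M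
  have hle := le_of_tendsto (b := -greenFlux n) hlim ?_
  · linarith
  filter_upwards [eventually_closedBall_add_subset hDo hε hb, self_mem_nhdsWithin] with s hs hs0
  rw [← integral_inner_gradient_const_smul hs0 hs hu.1.1,
    ← integral_inner_gradient_greenFunction hn hε hv hs0 hs]
  -- Compare the Green's function with M u: both vanish on the frontier of `D`, and on the sphere
  -- the second is the constant M. No sign of M is needed.
  refine integral_inner_gradient_radialCutoff_le hDo hDb hε hs0 hs (hv.harmonicContOnCl hn hε)
    (hu.1.const_smul M) (fun y hy => ?_) fun y hy => ?_
  · simpa [hu.2.1 y hy, mem_sphere_iff_norm.1 hy] using hM y hy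
  · simp [hu.2.2 y hy, hv.2 y hy]

/-- An upper bound for the flux, from a lower bound for the Green's function on the sphere. -/
theorem IsFlux.le_greenFlux (hn : 2 ≤ n) (hDo : IsOpen D) (hDb : Bornology.IsBounded D)
    (hF : IsFlux D ε x F) (hv : IsGreenRegularPart D x v) {m : ℝ}
    (hm : ∀ y ∈ Metric.sphere x ε, m ≤ greenSingularity n ε + v y) : m * F ≤ greenFlux n := by
  have := nontrivial_euclideanSpace hn
  obtain ⟨hε, hb, u, g, hu, hg, rfl⟩ := hF
  have hlim := (IsFlux.tendsto hn hDo hε hb hg).const_mul m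
  have hle := ge_of_tendsto (b := -greenFlux n) hlim ?_
  · linarith
  filter_upwards [eventually_closedBall_add_subset hDo hε hb, self_mem_nhdsWithin] with s hs hs0
  rw [← integral_inner_gradient_const_smul hs0 hs hu.1.1,
    ← integral_inner_gradient_greenFunction hn hε hv hs0 hs]
  refine integral_inner_gradient_radialCutoff_le hDo hDb hε hs0 hs (hu.1.const_smul m)
    (hv.harmonicContOnCl hn hε) (fun y hy => ?_) fun y hy => ?_
  · simpa [hu.2.1 y hy, mem_sphere_iff_norm.1 hy] using hm y hy
  · simp [hu.2.2 y hy, hv.2 y hy]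

end FluxBounds

/-! ### The Kelvin transform -/

section Kelvin

variable {E : Type*} [NormedAddCommGroup E] [InnerProductSpace ℝ E] [FiniteDimensional ℝ E] {n : ℕ}

/-- The squared distance to `x`, normalized by `a`. -/
noncomputable def kelvinScale (a : ℝ) (x z : E) : ℝ := ‖z - x‖ ^ 2 / a

/-- The inversion in the sphere of squared radius `a` about `x`. -/
noncomputable def kelvinPoint (a : ℝ) (x z : E) : E := x + (kelvinScale a x z)⁻¹ • (z - x)

/-- The Kelvin transform, in dimension `n`, with respect to the sphere of squared radius `a`
about `x`. -/
noncomputable def kelvinTransform (n : ℕ) (a : ℝ) (x : E) (h : E → ℝ) (z : E) : ℝ :=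
  kelvinScale a x z ^ (1 - (n : ℝ) / 2) * h (kelvinPoint a x z)

variable {a : ℝ} {x y : E}

theorem kelvinScale_pos (ha : 0 < a) (h : y ≠ x) : 0 < kelvinScale a x y := by
  have := norm_pos_iff.2 (sub_ne_zero.2 h)
  unfold kelvinScale
  positivity

theorem contDiff_kelvinScale {m : WithTop ℕ∞} : ContDiff ℝ m (kelvinScale a x) :=
  ((contDiff_id.sub contDiff_const).norm_sq ℝ).div_const a

theorem contDiffAt_kelvinPoint (ha : 0 < a) (h : y ≠ x) {m : WithTop ℕ∞} :
    ContDiffAt ℝ m (kelvinPoint a x) y :=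
  contDiffAt_const.add ((contDiff_kelvinScale.contDiffAt.inv (kelvinScale_pos ha h).ne').smul
    (contDiffAt_id.sub contDiffAt_const))

theorem contDiffAt_kelvinTransform (ha : 0 < a) (h : y ≠ x) {f : E → ℝ} {m : WithTop ℕ∞}
    (hf : ContDiffAt ℝ m f (kelvinPoint a x y)) : ContDiffAt ℝ m (kelvinTransform n a x f) y :=
  (contDiff_kelvinScale.contDiffAt.rpow_const_of_ne (kelvinScale_pos ha h).ne').mul
    (hf.comp y (contDiffAt_kelvinPoint ha h))

theorem hasDerivAt_kelvinScale (e : E) :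
    HasDerivAt (fun t : ℝ => kelvinScale a x (y + t • e)) (2 * inner ℝ (y - x) e / a) 0 := by
  have h : HasFDerivAt (fun z : E => ‖z - x‖ ^ 2) (fderiv ℝ (fun z : E => ‖z - x‖ ^ 2) y) y :=
    (((contDiff_id.sub contDiff_const).norm_sq ℝ (n := 1)).differentiable (by norm_num)
      y).hasFDerivAt
  have h1 := h.hasLineDerivAt e
  rw [fderiv_norm_sq_sub] at h1
  exact HasDerivAt.div_const h1 a

theorem hasDerivAt_inner_line {e : E} (he : ‖e‖ = 1) :
    HasDerivAt (fun t : ℝ => inner ℝ (y + t • e - x) e) 1 0 := by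
  have h1 : (fun t : ℝ => inner ℝ (y + t • e - x) e) = fun t => inner ℝ (y - x) e + t := by
    funext t
    rw [show y + t • e - x = (y - x) + t • e by abel, inner_add_left, real_inner_smul_left,
      real_inner_self_eq_norm_sq, he]
    ring
  rw [h1]
  exact (hasDerivAt_id _).const_add _

/-- The derivative of the inversion in the direction `e`. -/
noncomputable def kelvinDeriv (a : ℝ) (x e z : E) : E :=
  (kelvinScale a x z)⁻¹ • e
    - (2 * inner ℝ (z - x) e / a * (kelvinScale a x z)⁻¹ ^ 2) • (z - x)

theorem hasDerivAt_kelvinPoint (ha : 0 < a) (h : y ≠ x) (e : E) :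
    HasDerivAt (fun t : ℝ => kelvinPoint a x (y + t • e)) (kelvinDeriv a x e y) 0 := by
  have hs := (hasDerivAt_kelvinScale (a := a) (x := x) (y := y) e).inv
    (by simpa using (kelvinScale_pos ha h).ne')
  refine ((hs.smul ((hasDerivAt_line y e 0).sub_const x)).const_add x).congr_deriv ?_
  simp only [kelvinDeriv, zero_smul, add_zero, Pi.inv_apply]
  have h2 : -(2 * inner ℝ (y - x) e / a) / kelvinScale a x y ^ 2
      = -(2 * inner ℝ (y - x) e / a * (kelvinScale a x y)⁻¹ ^ 2) := by
    rw [neg_div, div_eq_mul_inv _ (kelvinScale a x y ^ 2), inv_pow]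
  rw [h2, neg_smul]
  exact (sub_eq_add_neg _ _).symm

theorem fderiv_kelvinTransform (ha : 0 < a) (h : y ≠ x) {f : E → ℝ}
    (hf : DifferentiableAt ℝ f (kelvinPoint a x y))
    (hk : DifferentiableAt ℝ (kelvinTransform n a x f) y)
    (e : E) :
    fderiv ℝ (kelvinTransform n a x f) y e
      = 2 * inner ℝ (y - x) e / a * (1 - (n : ℝ) / 2)
          * kelvinScale a x y ^ (1 - (n : ℝ) / 2 - 1) * f (kelvinPoint a x y)
        + kelvinScale a x y ^ (1 - (n : ℝ) / 2)
          * fderiv ℝ f (kelvinPoint a x y) (kelvinDeriv a x e y) := by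
  have hs := (hasDerivAt_kelvinScale (a := a) (x := x) (y := y) e).rpow_const
    (p := 1 - (n : ℝ) / 2) (Or.inl (by simpa using (kelvinScale_pos ha h).ne'))
  have hf' : HasFDerivAt f (fderiv ℝ f (kelvinPoint a x y)) (kelvinPoint a x (y + (0 : ℝ) • e)) := by
    simpa using hf.hasFDerivAt
  have hfT := hf'.comp_hasDerivAt (0 : ℝ) (hasDerivAt_kelvinPoint ha h e)
  have hkl := hk.hasFDerivAt.hasLineDerivAt e
  refine HasDerivAt.unique hkl ((hs.mul hfT).congr_deriv ?_)
  simp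

theorem laplacian_kelvinTransform (ha : 0 < a) (hdim : Module.finrank ℝ E = n) (h : y ≠ x)
    {f : E → ℝ} (hf : HarmonicAt f (kelvinPoint a x y)) : (Δ (kelvinTransform n a x f)) y = 0 := by
  have hσ : 0 < kelvinScale a x y := kelvinScale_pos ha h
  set σ := kelvinScale a x y with hσdef
  set L := fderiv ℝ f (kelvinPoint a x y) with hL
  set B := fderiv ℝ (fderiv ℝ f) (kelvinPoint a x y) with hB
  set w := y - x with hw
  set p : ℝ := 1 - (n : ℝ) / 2 with hp
  set P := σ ^ p with hP
  have hBd : HasFDerivAt (fderiv ℝ f) B (kelvinPoint a x y) :=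
    ((hf.1.fderiv_right (m := 1) (by norm_num)).differentiableAt (by norm_num)).hasFDerivAt
  -- The terms are kept in monomials in ⟨w, e⟩, L and B so that each can be summed over an
  -- orthonormal basis separately.
  have key : ∀ e : E, ‖e‖ = 1 → iteratedFDeriv ℝ 2 (kelvinTransform n a x f) y ![e, e]
      = (4 * p * (p - 1) / a ^ 2 * P / σ ^ 2 * f (kelvinPoint a x y)) * inner ℝ w e ^ 2
        + 2 * p / a * P / σ * f (kelvinPoint a x y)
        + (4 * p / a * P / σ ^ 2 - 4 / a * P / σ ^ 2) * (inner ℝ w e * L e)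
        + (8 / a ^ 2 * P / σ ^ 3 - 8 * p / a ^ 2 * P / σ ^ 3) * L w * inner ℝ w e ^ 2
        - 2 / a * P / σ ^ 2 * L w
        + P / σ ^ 2 * B e e
        - 2 / a * P / σ ^ 3 * (inner ℝ w e * B e w)
        - 2 / a * P / σ ^ 3 * (inner ℝ w e * B w e)
        + 4 / a ^ 2 * P / σ ^ 4 * B w w * inner ℝ w e ^ 2 := by
    intro e he
    refine iteratedFDeriv_two_eq_of_hasDerivAt
      (contDiffAt_kelvinTransform ha h hf.1)
      (q := fun z => 2 * inner ℝ (z - x) e / a * p * kelvinScale a x z ^ (p - 1)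
          * f (kelvinPoint a x z) + kelvinScale a x z ^ p
          * fderiv ℝ f (kelvinPoint a x z) (kelvinDeriv a x e z)) ?_ ?_
    · have h1 := (contDiffAt_kelvinPoint ha h (m := 0)).continuousAt.eventually hf.eventually
      filter_upwards [isOpen_ne.mem_nhds h, h1] with z hz hfz
      exact fderiv_kelvinTransform ha hz (hfz.1.differentiableAt (by norm_num))
        ((contDiffAt_kelvinTransform ha hz hfz.1).differentiableAt (by norm_num)) e
    · have hs0 : kelvinScale a x (y + (0 : ℝ) • e) = σ := by simp [hσdef]
      have hp0 : kelvinPoint a x (y + (0 : ℝ) • e) = kelvinPoint a x y := by simp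
      have hs := hasDerivAt_kelvinScale (a := a) (x := x) (y := y) e
      have hsp := hs.rpow_const (p := p) (Or.inl (by rw [hs0]; exact hσ.ne'))
      have hsp1 := hs.rpow_const (p := p - 1) (Or.inl (by rw [hs0]; exact hσ.ne'))
      have hsi := hs.inv (by rw [hs0]; exact hσ.ne')
      have hβ := (((hasDerivAt_inner_line (x := x) (y := y) he).const_mul 2).div_const a)
      have hT := hasDerivAt_kelvinPoint ha h e
      have hf0 : HasFDerivAt f L (kelvinPoint a x (y + (0 : ℝ) • e)) := by
        rw [hp0]; exact (hf.1.differentiableAt (by norm_num)).hasFDerivAt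
      have hB0 : HasFDerivAt (fderiv ℝ f) B (kelvinPoint a x (y + (0 : ℝ) • e)) := by
        rw [hp0]; exact hBd
      have hfT := hf0.comp_hasDerivAt (0 : ℝ) hT
      have hLT := hB0.comp_hasDerivAt (0 : ℝ) hT
      have hX := (hsi.smul_const e).sub
        ((hβ.mul (hsi.pow 2)).smul ((hasDerivAt_line y e 0).sub_const x))
      refine ((((hβ.mul_const p).mul hsp1).mul hfT).add (hsp.mul (hLT.clm_apply hX))).congr_deriv ?_
      have hp1 : σ ^ (p - 1) = P / σ := by rw [Real.rpow_sub_one hσ.ne']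
      have hp2 : σ ^ (p - 1 - 1) = P / σ / σ := by
        rw [Real.rpow_sub_one hσ.ne', Real.rpow_sub_one hσ.ne']
      simp only [Pi.mul_apply, Pi.pow_apply, Pi.inv_apply, Pi.sub_apply, Pi.smul_apply',
        Function.comp_apply, hp1, hp2, Nat.add_one_sub_one, pow_one, zero_smul, add_zero, kelvinDeriv, ← hσdef,
        ← hw, ← hL, ← hP, map_sub, map_add, map_smul, smul_eq_mul, sub_apply, smul_apply]
      field_simp
      ring
  set b := stdOrthonormalBasis ℝ E with hb
  have hww : inner ℝ w w = a * σ := by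
    rw [hσdef, kelvinScale, real_inner_self_eq_norm_sq, hw]
    field_simp
  have hsum : ∀ φ : E →L[ℝ] ℝ, ∑ i, inner ℝ w (b i) * φ (b i) = φ w := by
    intro φ
    conv_rhs => rw [← b.sum_repr' w]
    simp [real_inner_comm]
  have hsq : ∑ i, inner ℝ w (b i) ^ 2 = a * σ := by
    rw [← hww, ← b.sum_inner_mul_inner]
    exact Finset.sum_congr rfl fun i _ => by rw [sq, real_inner_comm w]
  have hlap : ∑ i, B (b i) (b i) = 0 := by
    have h0 := hf.2.self_of_nhds
    rw [laplacian_eq_iteratedFDeriv_stdOrthonormalBasis, Pi.zero_apply] at h0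
    rw [← h0]
    exact Finset.sum_congr rfl fun i _ => by rw [iteratedFDeriv_two_apply]; simp [b, hB]
  have hs1 := hsum L
  have hs2 := hsum (B.flip w)
  have hs3 := hsum (B w)
  simp only [ContinuousLinearMap.flip_apply] at hs2
  rw [laplacian_eq_iteratedFDeriv_stdOrthonormalBasis]
  simp only
  rw [Finset.sum_congr rfl fun i _ => key _ (b.orthonormal.1 i)]
  simp only [Finset.sum_add_distrib, Finset.sum_sub_distrib, ← Finset.mul_sum, hs1, hs2, hs3, hsq,
    hlap, Finset.sum_const, Finset.card_univ, Fintype.card_fin, hdim, nsmul_eq_mul]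
  -- The terms in B w w cancel as -2 - 2 + 4 in every dimension; those in f and in L w cancel
  -- precisely because n = 2 - 2p.
  have hn : (n : ℝ) = 2 - 2 * p := by rw [hp]; ring
  rw [hn]
  field_simp
  ring

/-- The Kelvin transform of a harmonic function is harmonic. -/
theorem harmonicAt_kelvinTransform (ha : 0 < a) (hdim : Module.finrank ℝ E = n) (h : y ≠ x)
    {f : E → ℝ} (hf : HarmonicAt f (kelvinPoint a x y)) :
    HarmonicAt (kelvinTransform n a x f) y := by
  refine ⟨contDiffAt_kelvinTransform ha h hf.1, ?_⟩
  have h1 := (contDiffAt_kelvinPoint ha h (m := 0)).continuousAt.eventually hf.eventually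
  filter_upwards [isOpen_ne.mem_nhds h, h1] with z hz hfz
  exact laplacian_kelvinTransform ha hdim hz hfz

end Kelvin

/-! ### An interior Lipschitz estimate by reflection -/

section GradientEstimate

variable {E : Type*} [NormedAddCommGroup E] [InnerProductSpace ℝ E] [FiniteDimensional ℝ E]

/-- The Laplacian may be computed in any orthonormal basis, in particular in the image of the
standard one under σ. -/
theorem harmonicAt_comp_isometry {f : E → ℝ} (σ : E ≃ₗᵢ[ℝ] E) {c y : E}
    (hf : HarmonicAt f (c + σ (y - c))) : HarmonicAt (fun z => f (c + σ (z - c))) y := by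
  have hT : ContDiff ℝ 2 fun z => c + σ (z - c) :=
    contDiff_const.add (σ.contDiff.comp (contDiff_id.sub contDiff_const))
  refine ⟨hf.1.comp y hT.contDiffAt, ?_⟩
  filter_upwards [hT.continuous.continuousAt.eventually hf.eventually] with p hp
  have hTd : ∀ z, HasFDerivAt (fun z => c + σ (z - c)) (σ : E →L[ℝ] E) z := fun z =>
    ((σ : E →L[ℝ] E).hasFDerivAt.comp z ((hasFDerivAt_id z).sub_const c)).const_add c
  have key : ∀ e : E, iteratedFDeriv ℝ 2 (fun z => f (c + σ (z - c))) p ![e, e]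
      = iteratedFDeriv ℝ 2 f (c + σ (p - c)) ![σ e, σ e] := by
    intro e
    refine iteratedFDeriv_two_eq_of_hasDerivAt (hp.1.comp p hT.contDiffAt)
      (q := fun z => fderiv ℝ f (c + σ (z - c)) (σ e)) ?_ ?_
    · filter_upwards [hT.continuous.continuousAt.eventually hp.eventually] with z hz
      have := (hz.1.differentiableAt (by norm_num)).hasFDerivAt.comp z (hTd z)
      rw [show (fun z => f (c + σ (z - c))) = f ∘ fun z => c + σ (z - c) from rfl, this.fderiv]
      rfl
    · have h1 := (hp.1.hasFDerivAt_fderiv_apply (σ e)).comp p (hTd p)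
      refine HasDerivAt.congr_deriv (h1.hasLineDerivAt e) ?_
      rw [iteratedFDeriv_two_apply]
      rfl
  rw [laplacian_eq_iteratedFDeriv_stdOrthonormalBasis]
  simp only [key]
  have h0 := hp.2.self_of_nhds
  rw [laplacian_eq_iteratedFDeriv_orthonormalBasis f ((stdOrthonormalBasis ℝ E).map σ)] at h0
  simpa using h0

/-- A harmonic quadratic polynomial, used as a barrier on half balls. -/
theorem harmonicAt_halfBallBarrier (A R : ℝ) {c e : E} (he : ‖e‖ = 1) (y : E) :
    HarmonicAt (fun z => A * (‖z - c‖ ^ 2 + Module.finrank ℝ E *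
      (R * inner ℝ (z - c) e - inner ℝ (z - c) e ^ 2))) y := by
  set N : ℝ := (Module.finrank ℝ E : ℝ)
  have hcd : ContDiff ℝ 2 (fun z => A * (‖z - c‖ ^ 2 + N *
      (R * inner ℝ (z - c) e - inner ℝ (z - c) e ^ 2))) := by
    have h1 : ContDiff ℝ 2 fun z => ‖z - c‖ ^ 2 := (contDiff_id.sub contDiff_const).norm_sq ℝ
    have h2 : ContDiff ℝ 2 fun z => inner ℝ (z - c) e :=
      (contDiff_id.sub contDiff_const).inner ℝ contDiff_const
    fun_prop
  refine ⟨hcd.contDiffAt, .of_forall fun p => ?_⟩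
  have hinner : ∀ z f : E, HasDerivAt (fun t : ℝ => inner ℝ (z + t • f - c) e) (inner ℝ f e) 0 := by
    intro z f
    have h1 : (fun t : ℝ => inner ℝ (z + t • f - c) e)
        = fun t => inner ℝ (z - c) e + t * inner ℝ f e := by
      funext t
      rw [show z + t • f - c = (z - c) + t • f by abel, inner_add_left, real_inner_smul_left]
    rw [h1]
    simpa using ((hasDerivAt_id (0 : ℝ)).mul_const (inner ℝ f e)).const_add (inner ℝ (z - c) e)
  have key : ∀ f : E, ‖f‖ = 1 → iteratedFDeriv ℝ 2 (fun z => A * (‖z - c‖ ^ 2 + N *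
      (R * inner ℝ (z - c) e - inner ℝ (z - c) e ^ 2))) p ![f, f]
      = A * (2 - 2 * N * inner ℝ f e ^ 2) := by
    intro f hf
    refine iteratedFDeriv_two_eq_of_hasDerivAt hcd.contDiffAt
      (q := fun z => A * (2 * inner ℝ (z - c) f + N * (R * inner ℝ f e
        - 2 * inner ℝ (z - c) e * inner ℝ f e))) (.of_forall fun z => ?_) ?_
    · have h1 := (hcd.differentiable (by norm_num) z).hasFDerivAt.hasLineDerivAt f
      have hs : HasDerivAt (fun t : ℝ => ‖z + t • f - c‖ ^ 2) (2 * inner ℝ (z - c) f) 0 := by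
        have := hasDerivAt_kelvinScale (a := 1) (x := c) (y := z) f
        simpa [kelvinScale] using this
      refine HasDerivAt.unique h1 (((hs.add ((((hinner z f).const_mul R).sub
        ((hinner z f).pow 2)).const_mul N)).const_mul A).congr_deriv ?_)
      simp
    · have hi := hasDerivAt_inner_line (x := c) (y := p) hf
      refine (((hi.const_mul 2).add (((((hinner p f).const_mul 2).mul_const (inner ℝ f e)).const_sub
        (R * inner ℝ f e)).const_mul N)).const_mul A).congr_deriv ?_
      ring
  set b := stdOrthonormalBasis ℝ E
  have hsq : ∑ i, inner ℝ (b i) e ^ 2 = 1 := by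
    have := b.sum_inner_mul_inner e e
    rw [real_inner_self_eq_norm_sq, he, one_pow] at this
    rw [← this]
    exact Finset.sum_congr rfl fun i _ => by rw [sq, real_inner_comm e]
  rw [laplacian_eq_iteratedFDeriv_stdOrthonormalBasis]
  simp only [Pi.zero_apply]
  rw [Finset.sum_congr rfl fun i _ => key _ (b.orthonormal.1 i), ← Finset.mul_sum,
    Finset.sum_sub_distrib, ← Finset.mul_sum, hsq]
  simp [N]
  right; ring

/-- The difference of `h` and its mirror image in the hyperplane through `c` orthogonal to `e` is
harmonic, vanishes on the hyperplane and is at most 2M in absolute value. On a half ball it is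
dominated by a harmonic quadratic barrier, which grows at most linearly in t along `e`. -/
theorem InnerProductSpace.HarmonicOnNhd.abs_sub_reflection_le [Nontrivial E] {h : E → ℝ} {c e : E}
    {R M t : ℝ} (he : ‖e‖ = 1) (hh : HarmonicOnNhd h (Metric.closedBall c R))
    (hM : ∀ y ∈ Metric.closedBall c R, |h y| ≤ M) (ht : 0 < t) (htR : t < R) :
    |h (c + t • e) - h (c - t • e)| ≤ 2 * M * Module.finrank ℝ E * t / R := by
  have hR : 0 < R := ht.trans htR
  set σ := (Submodule.span ℝ {e})ᗮ.reflection with hσ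
  set N : ℝ := (Module.finrank ℝ E : ℝ) with hN
  have hN1 : 1 ≤ N := Nat.one_le_cast.2 Module.finrank_pos
  set V : Set E := Metric.ball c R ∩ {y | 0 < inner ℝ (y - c) e} with hV
  have hM0 : 0 ≤ M := (abs_nonneg _).trans (hM c (Metric.mem_closedBall_self hR.le))
  have hVo : IsOpen V := Metric.isOpen_ball.inter (isOpen_lt continuous_const (by fun_prop))
  have hVb : Bornology.IsBounded V := Metric.isBounded_ball.subset inter_subset_left
  have hVc : closure V ⊆ Metric.closedBall c R ∩ {y | 0 ≤ inner ℝ (y - c) e} :=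
    closure_minimal (inter_subset_inter Metric.ball_subset_closedBall 
      fun y (hy : 0 < inner ℝ (y - c) e) => show 0 ≤ inner ℝ (y - c) e from hy.le)
      (Metric.isClosed_closedBall.inter (isClosed_le continuous_const (by fun_prop)))
  have hσmem : ∀ y ∈ Metric.closedBall c R, c + σ (y - c) ∈ Metric.closedBall c R := by
    intro y hy
    rw [mem_closedBall_iff_norm] at hy ⊢
    rwa [add_sub_cancel_left, σ.norm_map]
  set g : E → ℝ := h - fun z => h (c + σ (z - c)) with hg
  have hgh : HarmonicOnNhd g (Metric.closedBall c R) := fun y hy =>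
    (hh y hy).sub (harmonicAt_comp_isometry σ (hh _ (hσmem y hy)))
  -- The factor 2M / R² makes the barrier at least 2M on the round part of the boundary, where |z -
  -- c| = R and the remaining bracket is nonnegative because 0 ≤ ⟨z - c, e⟩ ≤ R.
  set b : E → ℝ := fun z => 2 * M / R ^ 2 * (‖z - c‖ ^ 2 + N *
      (R * inner ℝ (z - c) e - inner ℝ (z - c) e ^ 2)) with hb
  have hbh : HarmonicOnNhd b (Metric.closedBall c R) := fun y _ =>
    harmonicAt_halfBallBarrier _ R he y
  have hbd : ∀ y ∈ frontier V, |g y| ≤ b y := by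
    intro y hy
    have hyc := hVc hy.1
    have hyV : y ∉ V := fun h => hy.2 (by rwa [hVo.interior_eq])
    have hyn : ‖y - c‖ ≤ R := mem_closedBall_iff_norm.1 hyc.1
    have hl0 : 0 ≤ inner ℝ (y - c) e := hyc.2
    have hlR : inner ℝ (y - c) e ≤ R := by
      have := real_inner_le_norm (y - c) e
      rw [he, mul_one] at this
      linarith
    by_cases hl : inner ℝ (y - c) e = 0
    · have : σ (y - c) = y - c := Submodule.reflection_mem_subspace_eq_self
        (Submodule.mem_orthogonal_singleton_iff_inner_left.2 hl)
      have hgy : g y = 0 := by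
        simp only [hg, Pi.sub_apply, this, add_sub_cancel, sub_self]
      rw [hgy, abs_zero]
      simp only [hb, hl]
      have : (0:ℝ) ≤ 2 * M / R ^ 2 * ‖y - c‖ ^ 2 := by positivity
      simpa using this
    · have hynR : ‖y - c‖ = R := by
        refine le_antisymm hyn (not_lt.1 fun hlt => hyV ⟨?_, lt_of_le_of_ne hl0 (Ne.symm hl)⟩)
        rwa [mem_ball_iff_norm]
      have h1 : |g y| ≤ 2 * M := by
        have := abs_sub (h y) (h (c + σ (y - c)))
        have h2 := hM y hyc.1
        have h3 := hM _ (hσmem y hyc.1)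
        simp only [hg, Pi.sub_apply]
        linarith
      refine h1.trans ?_
      simp only [hb, hynR]
      rw [div_mul_eq_mul_div, le_div_iff₀ (by positivity)]
      refine mul_le_mul_of_nonneg_left ?_ (by positivity)
      have : 0 ≤ N * (R * inner ℝ (y - c) e - inner ℝ (y - c) e ^ 2) :=
        mul_nonneg (by linarith) (by nlinarith)
      linarith
  have hVsub : V ⊆ Metric.closedBall c R := fun y hy => Metric.ball_subset_closedBall hy.1
  have hcl : closure V ⊆ Metric.closedBall c R := hVc.trans inter_subset_left
  have hgc : HarmonicContOnCl g V := ⟨hgh.mono hVsub, hgh.continuousOn.mono hcl⟩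
  have hbc : HarmonicContOnCl b V := ⟨hbh.mono hVsub, hbh.continuousOn.mono hcl⟩
  have hn : ‖c + t • e - c‖ = t := by
    rw [add_sub_cancel_left, norm_smul, he, mul_one, Real.norm_of_nonneg ht.le]
  have hi : inner ℝ (c + t • e - c) e = t := by
    rw [add_sub_cancel_left, real_inner_smul_left, real_inner_self_eq_norm_sq, he]; simp
  have hmem : c + t • e ∈ closure V := subset_closure
    ⟨by rw [mem_ball_iff_norm, hn]; exact htR, by rw [mem_ofPred_eq, hi]; exact ht⟩
  have hgv : g (c + t • e) = h (c + t • e) - h (c - t • e) := by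
    simp only [hg, Pi.sub_apply, add_sub_cancel_left, map_smul]
    rw [hσ, Submodule.reflection_orthogonalComplement_singleton_eq_neg, smul_neg, sub_eq_add_neg c]
  have h1 := hgc.le_of_frontier hVo hVb hbc (fun y hy => (le_abs_self _).trans (hbd y hy)) _ hmem
  have h2 := hgc.neg.le_of_frontier hVo hVb hbc
    (fun y hy => (neg_le_abs _).trans (hbd y hy)) _ hmem
  rw [← hgv]
  refine (abs_le'.2 ⟨h1, h2⟩).trans ?_
  simp only [hb, hn, hi]
  rw [div_mul_eq_mul_div, div_le_div_iff₀ (by positivity) hR]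
  -- Here N ≥ 1 absorbs t² into N t².
  have h3 : t ^ 2 + N * (R * t - t ^ 2) ≤ N * (R * t) := by nlinarith [sq_nonneg t]
  calc 2 * M * (t ^ 2 + N * (R * t - t ^ 2)) * R ≤ 2 * M * (N * (R * t)) * R := by gcongr
    _ = _ := by ring

/-- An interior Lipschitz estimate for bounded harmonic functions. -/
theorem InnerProductSpace.HarmonicOnNhd.abs_sub_le [Nontrivial E] {h : E → ℝ} {x y : E} {R M : ℝ}
    (hh : HarmonicOnNhd h (Metric.closedBall x R))
    (hM : ∀ z ∈ Metric.closedBall x R, |h z| ≤ M) (hy : ‖y - x‖ < R) :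
    |h y - h x| ≤ 2 * M * Module.finrank ℝ E * ‖y - x‖ / R := by
  by_cases hyx : y = x
  · simp [hyx]
  have h0 : 0 < ‖y - x‖ := norm_pos_iff.2 (sub_ne_zero.2 hyx)
  set e : E := ‖y - x‖⁻¹ • (y - x) with he
  -- Reflecting about the midpoint swaps `x` and `y`. The ball of radius R/2 about it stays in the
  -- given ball, and halving both t and R leaves the ratio t / R unchanged.
  set c : E := x + (‖y - x‖ / 2) • e with hc
  have hen : ‖e‖ = 1 := by rw [he, norm_smul, norm_inv, norm_norm, inv_mul_cancel₀ h0.ne']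
  have hsub : Metric.closedBall c (R / 2) ⊆ Metric.closedBall x R := by
    refine Metric.closedBall_subset_closedBall' ?_
    rw [dist_eq_norm, hc, add_sub_cancel_left, norm_smul, hen, Real.norm_of_nonneg (by positivity)]
    linarith
  have key := (hh.mono hsub).abs_sub_reflection_le hen (fun z hz => hM z (hsub hz))
    (by positivity : 0 < ‖y - x‖ / 2) (by linarith)
  have h1 : c + (‖y - x‖ / 2) • e = y := by
    rw [hc, add_assoc, ← add_smul, add_halves, he, smul_smul, mul_inv_cancel₀ h0.ne', one_smul]
    abel
  have h2 : c - (‖y - x‖ / 2) • e = x := by rw [hc]; abel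
  rw [h1, h2] at key
  refine key.trans_eq ?_
  field_simp

end GradientEstimate

/-! ### Size of the Kelvin transform outside the ball -/

section KelvinBounds

variable {E : Type*} [NormedAddCommGroup E] [InnerProductSpace ℝ E] [FiniteDimensional ℝ E]
  {n : ℕ} {ε : ℝ} {x y : E}

theorem norm_kelvinPoint_sub (hy : y ≠ x) : ‖kelvinPoint (ε ^ 2) x y - x‖ = ε ^ 2 / ‖y - x‖ := by
  have h0 : 0 < ‖y - x‖ := norm_pos_iff.2 (sub_ne_zero.2 hy)
  rw [kelvinPoint, add_sub_cancel_left, norm_smul, kelvinScale, inv_div,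
    Real.norm_of_nonneg (by positivity)]
  field_simp

theorem norm_kelvinPoint_sub_le (hε : 0 < ε) (hy : ε ≤ ‖y - x‖) :
    ‖kelvinPoint (ε ^ 2) x y - x‖ ≤ ε := by
  have h0 : 0 < ‖y - x‖ := hε.trans_le hy
  rw [norm_kelvinPoint_sub (sub_ne_zero.1 (norm_pos_iff.1 h0)), div_le_iff₀ h0]
  nlinarith

theorem abs_kelvinTransform_le (hn : 2 ≤ n) (hε : 0 < ε) (hy : ε ≤ ‖y - x‖) (f : E → ℝ) :
    |kelvinTransform n (ε ^ 2) x f y| ≤ |f (kelvinPoint (ε ^ 2) x y)| := by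
  have h1 : 1 ≤ kelvinScale (ε ^ 2) x y := by
    rw [kelvinScale, one_le_div (by positivity)]
    exact pow_le_pow_left₀ hε.le hy 2
  have hn' : (2 : ℝ) ≤ n := by exact_mod_cast hn
  rw [kelvinTransform, abs_mul, abs_of_nonneg (by positivity)]
  exact mul_le_of_le_one_left (abs_nonneg _)
    (Real.rpow_le_one_of_one_le_of_nonpos h1 (by linarith))

theorem kelvinTransform_eq_of_norm_eq (hε : 0 < ε) (hy : ‖y - x‖ = ε) (f : E → ℝ) :
    kelvinTransform n (ε ^ 2) x f y = f y := by
  have h1 : kelvinScale (ε ^ 2) x y = 1 := by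
    rw [kelvinScale, hy, div_self (by positivity)]
  rw [kelvinTransform, kelvinPoint, h1]
  simp

/-- The Kelvin transform of a bounded harmonic function, normalized at the centre, is small. -/
theorem abs_kelvinTransform_sub_le [Nontrivial E] (hdim : Module.finrank ℝ E = n) (hn : 2 ≤ n)
    {R M : ℝ} (hε : 0 < ε) (hεR : ε ≤ R / (4 * n)) {h : E → ℝ}
    (hh : HarmonicOnNhd h (Metric.closedBall x R)) (hM : ∀ z ∈ Metric.closedBall x R, |h z| ≤ M)
    (hy : R < ‖y - x‖) :
    |kelvinTransform n (ε ^ 2) x (fun z => h z - h x) y| ≤ M / 2 := by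
  have hn' : (2 : ℝ) ≤ n := by exact_mod_cast hn
  rw [le_div_iff₀ (by positivity)] at hεR
  have hR : 0 < R := by nlinarith
  have hεR' : ε < R := by nlinarith
  have hM0 : 0 ≤ M := (abs_nonneg _).trans (hM x (Metric.mem_closedBall_self hR.le))
  have hp := norm_kelvinPoint_sub_le hε (hεR'.le.trans hy.le)
  refine (abs_kelvinTransform_le hn hε (hεR'.le.trans hy.le) _).trans
    ((hh.abs_sub_le hM (hp.trans_lt hεR')).trans ?_)
  -- The inverted point lies within ε of `x`, so the Lipschitz bound is 2Mnε / R; the threshold R /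
  -- (4n) makes it at most M / 2.
  rw [hdim, div_le_div_iff₀ hR two_pos]
  calc 2 * M * n * ‖kelvinPoint (ε ^ 2) x y - x‖ * 2 ≤ 2 * M * n * ε * 2 := by gcongr
    _ = M * (ε * (4 * n)) := by ring
    _ ≤ M * R := by gcongr

end KelvinBounds

/-! ### Existence of the potential and its flux -/

section FluxExistence

variable {n : ℕ} {D : Set (EuclideanSpace ℝ (Fin n))} {x : EuclideanSpace ℝ (Fin n)} {ε : ℝ}

/-- Boundary data as elements of the complete space C(∂D, ℝ), in which the contraction principle is
applied. -/
theorem DirichletSolvable.exists_extension (hDir : DirichletSolvable D) (φ : C(frontier D, ℝ)) :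
    ∃ u, HarmonicContOnCl u D ∧ ∀ y : frontier D, u y = φ y := by
  classical
  obtain ⟨u, hu, hfr⟩ := hDir (fun y => if hy : y ∈ frontier D then φ ⟨y, hy⟩ else 0) (by
    rw [continuousOn_iff_continuous_domRestrict]
    refine φ.continuous.congr fun y => ?_
    simp [domRestrict])
  exact ⟨u, hu, fun y => (hfr y y.2).trans (dif_pos y.2)⟩

theorem lt_norm_sub_of_mem_frontier {R : ℝ} (hDo : IsOpen D) (hR : Metric.closedBall x R ⊆ D)
    {y : EuclideanSpace ℝ (Fin n)} (hy : y ∈ frontier D) : R < ‖y - x‖ := by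
  by_contra! h
  have := hR (mem_closedBall_iff_norm.2 h)
  rw [hDo.frontier_eq] at hy
  exact hy.2 this

theorem kelvinPoint_mem (hε : 0 < ε) (hb : Metric.closedBall x ε ⊆ D)
    {y : EuclideanSpace ℝ (Fin n)} (hy : ε ≤ ‖y - x‖) : kelvinPoint (ε ^ 2) x y ∈ D :=
  hb (mem_closedBall_iff_norm.2 (norm_kelvinPoint_sub_le hε hy))

/-- For small radii there is a harmonic function in `D` whose boundary values are those of
its normalized Kelvin transform minus the singularity of the Green's function. -/
theorem exists_harmonic_eq_kelvinTransform (hn : 2 ≤ n) (hDo : IsOpen D)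
    (hDb : Bornology.IsBounded D) (hDir : DirichletSolvable D) {R C : ℝ}
    (hR : Metric.closedBall x R ⊆ D) (hC : ∀ y ∈ frontier D, |greenSingularity n ‖y - x‖| ≤ C)
    (hC0 : 0 ≤ C) (hε : 0 < ε) (hεR : ε ≤ R / (4 * n)) :
    ∃ h, HarmonicContOnCl h D ∧ |h x| ≤ 2 * C ∧ ∀ y ∈ frontier D, h y =
      kelvinTransform n (ε ^ 2) x (fun z => h z - h x) y - greenSingularity n ‖y - x‖ := by
  have hnt := nontrivial_euclideanSpace hn
  have : CompactSpace (frontier D) := isCompact_iff_compactSpace.1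
    (hDb.isCompact_closure.of_isClosed_subset isClosed_frontier frontier_subset_closure)
  have hn' : (2 : ℝ) ≤ n := by exact_mod_cast hn
  have hεR' : ε ≤ R := by
    rw [le_div_iff₀ (by positivity)] at hεR
    nlinarith
  have hR0 : 0 < R := hε.trans_le hεR'
  have hb : Metric.closedBall x ε ⊆ D := (Metric.closedBall_subset_closedBall hεR').trans hR
  have hxD : x ∈ D := hR (Metric.mem_closedBall_self hR0.le)
  have hcl : Metric.closedBall x R ⊆ closure D := hR.trans subset_closure
  choose H hH hHφ using hDir.exists_extension
  have hfrR : ∀ y : frontier D, R < ‖(y : EuclideanSpace ℝ (Fin n)) - x‖ := fun y =>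
    lt_norm_sub_of_mem_frontier hDo hR y.2
  have hfrx : ∀ y : frontier D, (y : EuclideanSpace ℝ (Fin n)) ≠ x := fun y h => by
    have := hfrR y
    rw [h, sub_self, norm_zero] at this
    linarith
  have hcont : ∀ φ, Continuous fun y : frontier D =>
      kelvinTransform n (ε ^ 2) x (fun z => H φ z - H φ x) y
        - greenSingularity n ‖(y : EuclideanSpace ℝ (Fin n)) - x‖ := by
    intro φ
    refine continuous_iff_continuousAt.2 fun y => ?_
    have h1 : ContDiffAt ℝ 0 (fun z => H φ z - H φ x) (kelvinPoint (ε ^ 2) x y) :=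
      (((hH φ).contDiffAt (kelvinPoint_mem hε hb (hεR'.trans (hfrR y).le))).of_le
        (by norm_num)).sub contDiffAt_const
    have h2 := (contDiffAt_kelvinTransform (n := n) (by positivity : 0 < ε ^ 2) (hfrx y)
      h1).sub (contDiffAt_greenSingularity_norm (n := n) (hfrx y) (m := 0))
    exact h2.continuousAt.comp continuous_subtype_val.continuousAt
  -- Extend φ harmonically to `D`, then take the boundary values that h is required to have. By the
  -- maximum principle and the Kelvin bound this map contracts by 1/2.
  set Φ : C(frontier D, ℝ) → C(frontier D, ℝ) := fun φ => ⟨_, hcont φ⟩ with hΦ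
  have hΦc : ContractingWith (1 / 2) Φ := by
    refine ⟨by rw [← NNReal.coe_lt_coe]; norm_num, LipschitzWith.of_dist_le_mul fun φ ψ => ?_⟩
    rw [ContinuousMap.dist_le (by positivity)]
    intro y
    have hM := ((hH φ).sub (hH ψ)).abs_le_of_frontier hDo hDb (M := dist φ ψ) fun z hz => by
      rw [Pi.sub_apply, hHφ φ ⟨z, hz⟩, hHφ ψ ⟨z, hz⟩, ← Real.dist_eq]
      exact ContinuousMap.dist_apply_le_dist _
    have hk := abs_kelvinTransform_sub_le (by simp) hn hε hεR
      (((hH φ).sub (hH ψ)).1.mono hR) (fun z hz => hM z (hcl hz)) (hfrR y)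
    rw [Real.dist_eq]
    refine le_of_eq_of_le (congrArg _ ?_) (hk.trans_eq ?_)
    · simp only [hΦ, ContinuousMap.coe_mk, kelvinTransform, Pi.sub_apply]
      ring
    · simp; ring
  obtain ⟨φ, hφ⟩ : ∃ φ, Φ φ = φ := ⟨_, hΦc.fixedPoint_isFixedPt⟩
  have hφy : ∀ y : frontier D, φ y = kelvinTransform n (ε ^ 2) x (fun z => H φ z - H φ x) y
      - greenSingularity n ‖(y : EuclideanSpace ℝ (Fin n)) - x‖ := fun y => by
    conv_lhs => rw [← hφ]
    rfl
  have hM := (hH φ).abs_le_of_frontier hDo hDb (M := ‖φ‖) fun z hz => by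
    rw [hHφ φ ⟨z, hz⟩]
    exact φ.norm_coe_le_norm _
  -- The fixed-point equation bounds its own solution: ‖φ‖ ≤ 2C, uniformly in ε.
  have hnorm : ‖φ‖ ≤ C + ‖φ‖ / 2 := by
    rw [ContinuousMap.norm_le _ (by positivity)]
    intro y
    have hk := abs_kelvinTransform_sub_le (by simp) hn hε hεR ((hH φ).1.mono hR)
      (fun z hz => hM z (hcl hz)) (hfrR y)
    rw [hφy y, Real.norm_eq_abs]
    refine (abs_sub _ _).trans ?_
    linarith [hC y y.2]
  refine ⟨H φ, hH φ, (hM x (subset_closure hxD)).trans (by linarith), fun y hy => ?_⟩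
  rw [hHφ φ ⟨y, hy⟩, hφy]

/-- Heat fluxes exist for small balls. -/
theorem eventually_exists_isFlux (hn : 2 ≤ n) (hDo : IsOpen D) (hDb : Bornology.IsBounded D)
    (hDir : DirichletSolvable D) (hx : x ∈ D) : ∀ᶠ ε in 𝓝[>] (0 : ℝ), ∃ F, IsFlux D ε x F := by
  have hnt := nontrivial_euclideanSpace hn
  obtain ⟨R, hR0, hR⟩ := Metric.nhds_basis_closedBall.mem_iff.1 (hDo.mem_nhds hx)
  have hfrx : ∀ y ∈ frontier D, y ≠ x := fun y hy h => by
    have := lt_norm_sub_of_mem_frontier hDo hR hy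
    rw [h, sub_self, norm_zero] at this
    linarith
  obtain ⟨C, hC⟩ := (hDb.isCompact_closure.of_isClosed_subset isClosed_frontier
    frontier_subset_closure).exists_bound_of_continuousOn
    (f := fun y => greenSingularity n ‖y - x‖) fun y hy =>
      (contDiffAt_greenSingularity_norm (hfrx y hy) (m := 0)).continuousAt.continuousWithinAt
  have hn' : (2 : ℝ) ≤ n := by exact_mod_cast hn
  -- The first condition is for the contraction; the second, with |h x| ≤ 2|C|, makes the
  -- normalizing constant of `u` positive.
  filter_upwards [Ioo_mem_nhdsGT (show (0 : ℝ) < R / (4 * n) by positivity),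
    (tendsto_greenSingularity hn).eventually_gt_atTop (2 * |C|)] with ε hεI hεG
  have hε : 0 < ε := hεI.1
  have hεR := hεI.2.le
  have hεR' : ε ≤ R := by
    rw [le_div_iff₀ (by positivity)] at hεR
    nlinarith
  have hb : Metric.closedBall x ε ⊆ D := (Metric.closedBall_subset_closedBall hεR').trans hR
  obtain ⟨h, hh, hhx, hhfr⟩ := exists_harmonic_eq_kelvinTransform hn hDo hDb hDir hR
    (fun y hy => (hC y hy).trans (le_abs_self C)) (abs_nonneg C) hε hεR
  have hpos : 0 < greenSingularity n ε + h x := by linarith [(abs_le.1 hhx).1]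
  set k : EuclideanSpace ℝ (Fin n) → ℝ := kelvinTransform n (ε ^ 2) x fun z => h z - h x with hk
  set G : EuclideanSpace ℝ (Fin n) → ℝ := fun z => greenSingularity n ‖z - x‖ with hG
  -- On the sphere the Kelvin transform fixes values, so h - k is the constant h x and the numerator
  -- is the normalizing constant. On the frontier of `D` the numerator vanishes by the choice of h.
  set u : EuclideanSpace ℝ (Fin n) → ℝ := (greenSingularity n ε + h x)⁻¹ • (h - k + G) with hu
  have hne : ∀ y, y ∉ Metric.ball x ε → y ≠ x := by
    rintro y hy rfl
    exact hy (Metric.mem_ball_self hε)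
  have hle : ∀ y, y ∉ Metric.ball x ε → ε ≤ ‖y - x‖ := fun y hy => by
    rwa [mem_ball_iff_norm, not_lt] at hy
  have hkh : HarmonicOnNhd k (Metric.ball x ε)ᶜ := fun y hy =>
    harmonicAt_kelvinTransform (by positivity) (by simp) (hne y hy)
      ((hh.1 _ (kelvinPoint_mem hε hb (hle y hy))).sub (harmonicAt_const _))
  have hGh : HarmonicOnNhd G (Metric.ball x ε)ᶜ := fun y hy =>
    harmonicAt_greenSingularity hn (by simp) (hne y hy)
  -- Only the open ball is removed: `u` is harmonic across the sphere, so its own gradient is the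
  -- required continuous extension.
  have huh : HarmonicOnNhd u (D \ Metric.ball x ε) := fun y hy =>
    ((((hh.1 y hy.1).sub (hkh y hy.2)).add (hGh y hy.2))).const_smul
  have huc : ContinuousOn u (closure D \ Metric.ball x ε) :=
    (((hh.2.mono sdiff_subset).sub (hkh.continuousOn.mono fun y hy => hy.2)).add
      (hGh.continuousOn.mono fun y hy => hy.2)).const_smul _
  refine ⟨sphereFlux ε x (gradient u), hε, hb, u, gradient u, ⟨⟨?_, ?_⟩, ?_, ?_⟩,
    ⟨huh.continuousOn_gradient, fun y _ => rfl⟩, rfl⟩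
  · exact huh.mono (sdiff_subset_sdiff_right Metric.ball_subset_closedBall)
  · exact huc.mono closure_diff_closedBall_subset
  · intro y hy
    have hyn : ‖y - x‖ = ε := mem_sphere_iff_norm.1 hy
    simp only [hu, hk, hG, Pi.smul_apply, Pi.add_apply, Pi.sub_apply, smul_eq_mul,
      kelvinTransform_eq_of_norm_eq hε hyn, hyn]
    field_simp
    ring
  · intro y hy
    simp only [hu, hk, hG, Pi.smul_apply, Pi.add_apply, Pi.sub_apply, smul_eq_mul]
    rw [hhfr y hy]
    ring

end FluxExistence

/-! ### Minimizers, boundary behaviour and dependence on the pole -/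

section LeastCapacity

variable {n : ℕ} {D : Set (EuclideanSpace ℝ (Fin n))}
  {v : EuclideanSpace ℝ (Fin n) → EuclideanSpace ℝ (Fin n) → ℝ}

/-- At flux minimizers the regular part of the Green's function is asymptotically at least as large
as at any other point. -/
theorem eventually_exists_sphere_le (hn : 2 ≤ n) (hDo : IsOpen D) (hDb : Bornology.IsBounded D)
    (hDir : DirichletSolvable D) (hv : ∀ p ∈ D, IsGreenRegularPart D p (v p))
    {x : ℝ → EuclideanSpace ℝ (Fin n)} (hx : ∀ᶠ ε in 𝓝[>] (0 : ℝ), IsFluxMinimizer D ε (x ε))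
    {z : EuclideanSpace ℝ (Fin n)} (hz : z ∈ D) {δ : ℝ} (hδ : 0 < δ) :
    ∀ᶠ ε in 𝓝[>] (0 : ℝ), 0 < ε ∧ Metric.closedBall (x ε) ε ⊆ D ∧
      ∃ y ∈ Metric.sphere (x ε) ε, v z z - δ ≤ v (x ε) y := by
  have hcont : ContinuousAt (v z) z := ((hv z hz).1.contDiffAt hz).continuousAt
  obtain ⟨ρ, hρ, hρv⟩ := Metric.continuousAt_iff.1 hcont (δ / 2) (by positivity)
  filter_upwards [hx, eventually_exists_isFlux hn hDo hDb hDir hz, Ioo_mem_nhdsGT hρ,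
    (tendsto_greenSingularity hn).eventually_gt_atTop (δ / 2 - v z z)] with ε hmin hex hερ hεG
  obtain ⟨F, hF, hFmin⟩ := hmin
  obtain ⟨F', hF'⟩ := hex
  refine ⟨hF.1, hF.2.1, ?_⟩
  -- Otherwise γ ≤ (g(ε) + v_z(z) - δ) F, while (g(ε) + v_z(z) - δ/2) F' ≤ γ for the flux F' ≥ F
  -- about z. Subtracting gives (δ/2) F ≤ 0, so F = 0, contradicting γ > 0.
  by_contra! hlt
  have hxD : x ε ∈ D := hF.2.1 (Metric.mem_closedBall_self hF.1.le)
  have h1 := hF.greenFlux_le hn hDo hDb (hv _ hxD) (M := greenSingularity n ε + (v z z - δ))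
    fun y hy => by linarith [hlt y hy]
  have h2 := hF'.le_greenFlux hn hDo hDb (hv z hz) (m := greenSingularity n ε + (v z z - δ / 2))
    fun y hy => by
      have h3 := hρv (x := y) (by rw [Metric.mem_sphere.1 hy]; exact hερ.2)
      rw [Real.dist_eq] at h3
      linarith [(abs_lt.1 h3).1]
  have h4 : 0 < greenSingularity n ε + (v z z - δ / 2) := by linarith
  have h5 := mul_le_mul_of_nonneg_left (hFmin z F' hF') h4.le
  have h6 : F ≤ 0 := by nlinarith
  have h7 : F = 0 := le_antisymm h6 (hF.nonneg hn hDo hDb)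
  rw [h7, mul_zero] at h1
  exact absurd (greenFlux_pos hn) (not_lt.2 h1)

theorem norm_sub_pos_of_mem_frontier (hDo : IsOpen D) {x y : EuclideanSpace ℝ (Fin n)} (hx : x ∈ D)
    (hy : y ∈ frontier D) : 0 < ‖y - x‖ := by
  rw [norm_pos_iff, sub_ne_zero]
  rintro rfl
  rw [hDo.frontier_eq] at hy
  exact hy.2 hx

/-- The diagonal of the regular part of the Green's function tends to `-∞` at the boundary. -/
theorem exists_forall_greenRegularPart_lt (hn : 2 ≤ n) (hDo : IsOpen D)
    (hDb : Bornology.IsBounded D) (hDir : DirichletSolvable D)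
    (hv : ∀ p ∈ D, IsGreenRegularPart D p (v p)) {c : EuclideanSpace ℝ (Fin n)}
    (hc : c ∈ frontier D) (A : ℝ) :
    ∃ ρ > 0, ∀ x ∈ D, ∀ y ∈ D, dist x c < ρ → dist y c < ρ → v x y < A := by
  have hnt := nontrivial_euclideanSpace hn
  obtain ⟨δ, hδA, hδ⟩ := (((tendsto_greenSingularity hn).eventually_gt_atTop (1 - A)).and
    self_mem_nhdsWithin).exists
  have hδ : 0 < δ := hδ
  -- A majorant independent of the pole: adding δ to the distance keeps the data continuous at c,
  -- with the very negative value -g(δ) there. If |x - c| < δ then |ζ - x| ≤ |ζ - c| + δ, so v_x ≤ h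
  -- on the frontier.
  obtain ⟨h, hh, hhfr⟩ := hDir (fun y => -greenSingularity n (‖y - c‖ + δ)) (by
    refine ContinuousOn.neg fun y _ => ContinuousAt.continuousWithinAt ?_
    have h1 : ContinuousAt (greenSingularity n) (‖y - c‖ + δ) :=
      (contDiffAt_greenSingularity (by positivity) (m := 0)).continuousAt
    exact h1.comp (f := fun y => ‖y - c‖ + δ) (by fun_prop))
  have hhc : h c = -greenSingularity n δ := by rw [hhfr c hc]; simp
  obtain ⟨ρ, hρ, hρh⟩ := Metric.continuousWithinAt_iff.1
    (hh.2 c (frontier_subset_closure hc)) 1 one_pos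
  refine ⟨min ρ δ, lt_min hρ hδ, fun x hx y hy hxc hyc => ?_⟩
  have hle := (hv x hx).1.le_of_frontier hDo hDb hh (fun ζ hζ => ?_) y (subset_closure hy)
  · have h2 := hρh (subset_closure hy) (hyc.trans_le (min_le_left _ _))
    rw [Real.dist_eq, hhc] at h2
    linarith [(abs_lt.1 h2).2]
  · rw [(hv x hx).2 ζ hζ, hhfr ζ hζ, neg_le_neg_iff]
    refine (greenSingularity_strictAntiOn hn).antitoneOn (norm_sub_pos_of_mem_frontier hDo hx hζ)
      (show 0 < ‖ζ - c‖ + δ by positivity) ?_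
    have h3 := norm_sub_le_norm_sub_add_norm_sub ζ c x
    have h4 : ‖c - x‖ < δ := by
      rw [← dist_eq_norm, dist_comm]
      exact hxc.trans_le (min_le_right _ _)
    linarith

/-- The regular part of the Green's function depends upper semicontinuously on the pole, uniformly
in the other variable. -/
theorem eventually_greenRegularPart_le (hn : 2 ≤ n) (hDo : IsOpen D)
    (hDb : Bornology.IsBounded D) (hv : ∀ p ∈ D, IsGreenRegularPart D p (v p))
    {c : EuclideanSpace ℝ (Fin n)} (hc : c ∈ D) {δ : ℝ} (hδ : 0 < δ) :
    ∀ᶠ x in 𝓝 c, ∀ y ∈ D, v x y ≤ v c y + δ := by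
  have hnt := nontrivial_euclideanSpace hn
  have hcpt : IsCompact (frontier D) := hDb.isCompact_closure.of_isClosed_subset isClosed_frontier
    frontier_subset_closure
  have htube : ∀ᶠ x in 𝓝 c, ∀ ζ ∈ frontier D,
      greenSingularity n ‖ζ - c‖ - δ < greenSingularity n ‖ζ - x‖ := by
    -- The pole enters only through the boundary values; compactness of the frontier makes their
    -- continuity in the pole uniform, and the maximum principle carries it inside.
    refine hcpt.eventually_forall_of_forall_eventually fun ζ hζ => ?_
    have h0 := norm_sub_pos_of_mem_frontier hDo hc hζ
    have hG : ContinuousAt (greenSingularity n) ‖ζ - c‖ :=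
      (contDiffAt_greenSingularity h0 (m := 0)).continuousAt
    have h1 : Tendsto (fun p : EuclideanSpace ℝ (Fin n) × EuclideanSpace ℝ (Fin n) => ‖p.2 - c‖)
        (𝓝 (c, ζ)) (𝓝 ‖ζ - c‖) := Continuous.tendsto' (by fun_prop) _ _ rfl
    have h2 : Tendsto (fun p : EuclideanSpace ℝ (Fin n) × EuclideanSpace ℝ (Fin n) => ‖p.2 - p.1‖)
        (𝓝 (c, ζ)) (𝓝 ‖ζ - c‖) := Continuous.tendsto' (by fun_prop) _ _ rfl
    exact (((hG.tendsto.comp h1).sub_const δ).eventually_lt (hG.tendsto.comp h2)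
      (sub_lt_self _ hδ))
  filter_upwards [htube, hDo.mem_nhds hc] with x hx hxD y hy
  refine (hv x hxD).1.le_of_frontier hDo hDb ((hv c hc).1.add_const δ) (fun ζ hζ => ?_) y
    (subset_closure hy)
  rw [Pi.add_apply, (hv x hxD).2 ζ hζ, (hv c hc).2 ζ hζ]
  linarith [hx ζ hζ]

end LeastCapacity

/-! ### Passage to the limit -/

theorem theorem1 (n : ℕ) (hn : 2 ≤ n) (D : Set (EuclideanSpace ℝ (Fin n)))
    (hDo : IsOpen D) (hDc : IsConnected D) (hDb : Bornology.IsBounded D)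
    (hDir : DirichletSolvable D)
    (v : EuclideanSpace ℝ (Fin n) → EuclideanSpace ℝ (Fin n) → ℝ)
    (hv : ∀ p ∈ D, IsGreenRegularPart D p (v p))
    (c : EuclideanSpace ℝ (Fin n)) (hc : IsLeastCapacityPoint D c) :
    c ∈ D ∧ ∀ z ∈ D, v z z ≤ v c c := by
  obtain ⟨x, hmin, hxc⟩ := hc
  have hsph := fun {z} (hz : z ∈ D) {δ : ℝ} (hδ : 0 < δ) =>
    eventually_exists_sphere_le hn hDo hDb hDir hv hmin hz hδ
  obtain ⟨z₀, hz₀⟩ := hDc.nonempty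
  have hdist : ∀ {ρ ε : ℝ}, dist (x ε) c < ρ / 2 → ε < ρ / 2 → ∀ y ∈ Metric.sphere (x ε) ε,
      dist y c < ρ := by
    intro ρ ε h1 h2 y hy
    have h3 := dist_triangle y (x ε) c
    rw [Metric.mem_sphere.1 hy] at h3
    linarith
  have hnear : ∀ {ρ : ℝ}, 0 < ρ → ∀ᶠ ε in 𝓝[>] (0 : ℝ), dist (x ε) c < ρ / 2 ∧ ε < ρ / 2 :=
    fun hρ => (Metric.tendsto_nhds.1 hxc _ (by positivity)).and
      (mem_of_superset (Ioo_mem_nhdsGT (half_pos hρ)) fun _ h => h.2)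
  -- At a boundary limit both the pole and the sphere point approach c, where v falls below the
  -- lower bound v_{z₀}(z₀) - 1 valid along minimizers.
  have hcD : c ∈ D := by
    by_contra hcD
    have hcc : c ∈ closure D := mem_closure_of_tendsto hxc <| (hsph hz₀ one_pos).mono
      fun ε h => h.2.1 (Metric.mem_closedBall_self h.1.le)
    obtain ⟨ρ, hρ, hlt⟩ := exists_forall_greenRegularPart_lt hn hDo hDb hDir hv
      (show c ∈ frontier D by rw [hDo.frontier_eq]; exact ⟨hcc, hcD⟩) (v z₀ z₀ - 1)
    obtain ⟨ε, ⟨hε, hb, y, hy, hle⟩, hd, hερ⟩ := ((hsph hz₀ one_pos).and (hnear hρ)).exists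
    exact absurd hle (not_le.2 (hlt _ (hb (Metric.mem_closedBall_self hε.le)) y
      (hb (Metric.sphere_subset_closedBall hy)) (by linarith) (hdist hd hερ y hy)))
  refine ⟨hcD, fun z hz => le_of_forall_pos_le_add fun δ hδ => ?_⟩
  -- One third each for the estimate along minimizers, moving the pole from `x ε` to c, and moving
  -- the argument from y to c.
  have hδ3 : 0 < δ / 3 := by positivity
  have hcont : ContinuousAt (v c) c := ((hv c hcD).1.contDiffAt hcD).continuousAt
  obtain ⟨ρ, hρ, hρv⟩ := Metric.continuousAt_iff.1 hcont (δ / 3) hδ3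
  obtain ⟨ε, ⟨hε, hb, y, hy, hle⟩, ⟨hd, hερ⟩, hux⟩ := ((hsph hz hδ3).and ((hnear hρ).and
    (hxc.eventually (eventually_greenRegularPart_le hn hDo hDb hv hcD hδ3)))).exists
  have h1 := hux y (hb (Metric.sphere_subset_closedBall hy))
  have h2 := hρv (hdist hd hερ y hy)
  rw [Real.dist_eq] at h2
  linarith [(abs_lt.1 h2).2]
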